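/- For a finite graph $G$ and a set $S\subseteq V(G)$ let $N(S)=\{v\in V(G)\setminus S:\ v \text{ is adjacent to some } u\in S\}$, and for $p\in[0,1]$ let $G_p$ be the random subgraph of $G$ on the vertex set $V(G)$ obtained by retaining each edge of $G$ independently with probability $p$. There is an absolute constant $C>0$ such that for every $c\in(0,1)$ there is $\varepsilon_0=\varepsilon_0(c)>0$ such that for every $\varepsilon\in(0,\varepsilon_0]$ there is $\gamma=\gamma(\varepsilon,c)>0$ with the following property. Let $d\ge 1$ be an integer with $p:=\frac{1+\varepsilon}{d}\le 1$, let $G$ be a graph on $n$ vertices, and let $k\ge 1$ be an integer equal to $cn/d$ rounded up or down, i.e. $\left|k-\frac{cn}{d}\right|<1$. If every $S\subseteq V(G)$ with $|S|=k$ satisfies $|N(S)|\ge d|S|$, then $$\mathbb P\bigl(G_p\text{ contains a cycle of length at least } C\varepsilon^2c^2n\bigr)\ \ge\ 1-e^{-\gamma n}.$$ -/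

import Mathlib

open MeasureTheory ProbabilityTheory unitInterval

namespace Percolation

/-- The external neighbourhood `N(S)`: the vertices outside `S` with a neighbour in `S`. -/
noncomputable def extNbhd {V : Type*} [Fintype V] (G : SimpleGraph V) (S : Finset V) : Finset V :=
  open Classical in Finset.univ.filter fun v => v ∉ S ∧ ∃ u ∈ S, G.Adj u v

/-- `G` is a `(k, d)`-expander: every set `S` of exactly `k` vertices has `|N(S)| ≥ d |S|`. -/
def IsExpanderAt {V : Type*} [Fintype V] (G : SimpleGraph V) (k d : ℕ) : Prop :=
  ∀ S : Finset V, S.card = k → d * S.card ≤ (extNbhd G S).card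

/-- The law of the random subgraph `G_p` of `G`: every edge of `G` is retained independently with
probability `p`, and all vertices are kept. -/
noncomputable def randomSubgraph {V : Type*} (G : SimpleGraph V) (p : I) :
    Measure (SimpleGraph V) :=
  (setBernoulli G.edgeSet p).map SimpleGraph.fromEdgeSet

/-- `H` contains a cycle with at least `L` vertices (equivalently, edges). -/
def HasCycleOfLengthAtLeast {V : Type*} (H : SimpleGraph V) (L : ℝ) : Prop :=
  ∃ (v : V) (w : H.Walk v v), w.IsCycle ∧ L ≤ (w.length : ℝ)

end Percolation

/-! Write κ = ε²dk/10⁷. Since dk ≥ cn/2, a cycle of length κ is more than long enough. For large n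
it comes from two rounds of exposure. A first round of density p₁ = (1 + 3ε/4)/d produces more than
κ/p₁ edges of `G` whose ends are already joined by a path of length at least κ (`longEdges`). The
second round, of density p₂ ≥ (ε/64)p₁, hits one of them except with probability at most
exp(-(ε/64)κ).

The hypothesis concerns sets of exactly k vertices only. An extremal set X with |X| < k upgrades it
(`exists_reservoir`): outside X all sets of at most r vertices expand by (1 - ε/2 + e)d, where e²r ≥
ε²k/128. A small range r is thus compensated by a large surplus e, and the product e²dr is what
determines the cycle length.

Depth first search is run on the complement of X. Its answers are independent, so an exponential
martingale and a union bound over pairs of times show that, with high probability, in every time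
window p₁ · questions < (1 + ε/64) · positive answers + κ (`bexp_exists_badWindow_le`). By a
deterministic argument on the height of the stack (`exists_flat_period`), there is a period in which
many vertices are discovered although the stack hardly grows, so most of them, say P, are finished
at its end. Expansion gives P at least D|P| outgoing edges with p₁D ≥ 1 + e/2. Those leading to
unseen vertices were all asked within the period, so there are too few of them. If the period starts
from nothing, this is a contradiction; otherwise the rest leads back to vertices of the current tree
seen before the stack made a climb of height g ≥ κ, and each such edge closes a long path
(`lt_card_longEdges`).

For bounded n, `G` itself has a long enough cycle, by the same search with all edges present
(`IsExpanderAt.hasCycle`), and all edges survive with probability bounded below. -/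

namespace Percolation

/-! ### Binomial random subsets of a finite set, as finite sums -/

section RandomSubset

variable {α : Type*}

/-- The expectation of `f F`, where `F` is a random subset of `E` containing each element
independently with probability `p`. -/
noncomputable def bexp (E : Finset α) (p : ℝ) (f : Finset α → ℝ) : ℝ :=
  ∑ F ∈ E.powerset, p ^ F.card * (1 - p) ^ (E.card - F.card) * f F

lemma bexp_empty (p : ℝ) (f : Finset α → ℝ) : bexp ∅ p f = f ∅ := by
  simp [bexp]

lemma bexp_insert [DecidableEq α] {E : Finset α} {a : α} (ha : a ∉ E) (p : ℝ)
    (f : Finset α → ℝ) :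
    bexp (insert a E) p f = p * bexp E p (fun F => f (insert a F)) + (1 - p) * bexp E p f := by
  unfold bexp
  rw [Finset.sum_powerset_insert ha, add_comm, Finset.mul_sum, Finset.mul_sum]
  congr 1
  · refine Finset.sum_congr rfl fun F hF => ?_
    have hF' := Finset.mem_powerset.1 hF
    have : a ∉ F := fun h => ha (hF' h)
    rw [Finset.card_insert_of_notMem ha, Finset.card_insert_of_notMem this,
      Nat.add_sub_add_right]
    ring
  · refine Finset.sum_congr rfl fun F hF => ?_
    have := Finset.card_le_card (Finset.mem_powerset.1 hF)
    rw [Finset.card_insert_of_notMem ha, Nat.sub_add_comm this]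
    ring

lemma bexp_congr {E : Finset α} {p : ℝ} {f g : Finset α → ℝ} (h : ∀ F ⊆ E, f F = g F) :
    bexp E p f = bexp E p g :=
  Finset.sum_congr rfl fun F hF => by rw [h F (Finset.mem_powerset.1 hF)]

lemma bexp_add (E : Finset α) (p : ℝ) (f g : Finset α → ℝ) :
    bexp E p (fun F => f F + g F) = bexp E p f + bexp E p g := by
  simp [bexp, mul_add, Finset.sum_add_distrib]

lemma bexp_mul_left (E : Finset α) (p c : ℝ) (f : Finset α → ℝ) :
    bexp E p (fun F => c * f F) = c * bexp E p f := by
  simp only [bexp, Finset.mul_sum]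
  exact Finset.sum_congr rfl fun F _ => by ring

lemma bexp_sum {ι : Type*} (s : Finset ι) (E : Finset α) (p : ℝ) (f : ι → Finset α → ℝ) :
    bexp E p (fun F => ∑ i ∈ s, f i F) = ∑ i ∈ s, bexp E p (f i) := by
  simp only [bexp, Finset.mul_sum]
  exact Finset.sum_comm

lemma bexp_mono {E : Finset α} {p : ℝ} (h0 : 0 ≤ p) (h1 : p ≤ 1) {f g : Finset α → ℝ}
    (h : ∀ F ⊆ E, f F ≤ g F) : bexp E p f ≤ bexp E p g :=
  Finset.sum_le_sum fun F hF => mul_le_mul_of_nonneg_left (h F (Finset.mem_powerset.1 hF))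
    (mul_nonneg (pow_nonneg h0 _) (pow_nonneg (by linarith) _))

lemma bexp_const (E : Finset α) (p c : ℝ) : bexp E p (fun _ => c) = c := by
  classical
  induction E using Finset.induction_on with
  | empty => rw [bexp_empty]
  | insert a E ha ih => rw [bexp_insert ha, ih]; ring

/-- The union of two independent random subsets is again a random subset. -/
lemma bexp_union [DecidableEq α] (E : Finset α) {p p₁ p₂ : ℝ} (hp : 1 - p = (1 - p₁) * (1 - p₂))
    (f : Finset α → ℝ) :
    bexp E p f = bexp E p₁ (fun F₁ => bexp E p₂ (fun F₂ => f (F₁ ∪ F₂))) := by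
  induction E using Finset.induction_on generalizing f with
  | empty => simp [bexp_empty]
  | insert a E ha ih =>
    simp only [bexp_insert ha, bexp_add, bexp_mul_left, Finset.insert_union, Finset.union_insert,
      Finset.insert_idem]
    rw [ih, ih, show p = 1 - (1 - p₁) * (1 - p₂) by linarith]
    ring

/-- The probability that the random set misses a given set. -/
lemma bexp_disjoint [DecidableEq α] {E A : Finset α} (hA : A ⊆ E) (p : ℝ) :
    bexp E p (fun F => if Disjoint F A then 1 else 0) = (1 - p) ^ A.card := by
  induction E using Finset.induction_on generalizing A with
  | empty =>
    rw [Finset.subset_empty.1 hA]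
    simp [bexp_empty]
  | insert a E ha ih =>
    rw [bexp_insert ha]
    by_cases haA : a ∈ A
    · have h1 : bexp E p (fun F => if Disjoint (insert a F) A then (1 : ℝ) else 0) = 0 := by
        simp [Finset.disjoint_insert_left, haA, bexp_const]
      have h2 : bexp E p (fun F => if Disjoint F A then (1 : ℝ) else 0) =
          bexp E p (fun F => if Disjoint F (A.erase a) then 1 else 0) := by
        refine bexp_congr fun F hF => ?_
        have : a ∉ F := fun h => ha (hF h)
        simp only [← Finset.disjoint_erase_comm, Finset.erase_eq_of_notMem this]
      rw [h1, h2, ih (Finset.subset_insert_iff.1 hA),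
        ← Finset.card_erase_add_one haA]
      ring
    · have hA' : A ⊆ E := (Finset.subset_insert_iff_of_notMem haA).1 hA
      simp only [Finset.disjoint_insert_left, haA, not_false_iff, true_and]
      rw [ih hA']
      ring

lemma bexp_indep [DecidableEq α] {E : Finset α} {e : α} (he : e ∈ E) (p a b : ℝ)
    {g : Finset α → ℝ} (hg : ∀ F, g (insert e F) = g F) :
    bexp E p (fun F => (if e ∈ F then a else b) * g F) = (p * a + (1 - p) * b) * bexp E p g := by
  obtain ⟨E', he', rfl⟩ : ∃ E', e ∉ E' ∧ insert e E' = E :=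
    ⟨E.erase e, Finset.notMem_erase e E, Finset.insert_erase he⟩
  rw [bexp_insert he', bexp_insert he']
  simp only [hg, Finset.mem_insert_self, if_true]
  have : bexp E' p (fun F => (if e ∈ F then a else b) * g F) = bexp E' p (fun F => b * g F) :=
    bexp_congr fun F hF => by rw [if_neg fun h => he' (hF h)]
  rw [this, bexp_mul_left, bexp_mul_left]
  ring

end RandomSubset

/-! ### Adaptive exploration and the Chernoff bound for its time windows -/

section Exploration

variable {α τ : Type*}

/-- An adaptive exploration of a random subset of `E`: in state `s` it may ask whether an element
not asked before belongs to the random set, and moves on according to the answer. -/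
structure Exploration (α τ : Type*) [DecidableEq α] (E : Finset α) where
  /-- the next question -/
  ask : τ → Option α
  /-- the next state, given the answer (which is `false` if there is no question) -/
  next : τ → Bool → τ
  /-- the questions asked so far -/
  asked : τ → Finset α
  mem_of_ask : ∀ {s e}, ask s = some e → e ∈ E
  notMem_of_ask : ∀ {s e}, ask s = some e → e ∉ asked s
  asked_next_some : ∀ {s e} (b), ask s = some e → asked (next s b) = insert e (asked s)
  asked_next_none : ∀ {s} (b), ask s = none → asked (next s b) = asked s

namespace Exploration

variable [DecidableEq α] {E : Finset α} (X : Exploration α τ E)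

/-- The answer obtained in state `s` if the random set is `F`. -/
def ans (F : Finset α) (s : τ) : Bool :=
  match X.ask s with
  | some e => decide (e ∈ F)
  | none => false

/-- The state after `i` steps. -/
def run (F : Finset α) (s : τ) (i : ℕ) : τ := (fun s => X.next s (X.ans F s))^[i] s

/-- The number of questions asked in the steps `i ≤ t < j`. -/
def queries (F : Finset α) (s : τ) (i j : ℕ) : ℕ :=
  ((Finset.Ico i j).filter fun t => (X.ask (X.run F s t)).isSome).card

/-- The number of positive answers in the steps `i ≤ t < j`. -/
def positives (F : Finset α) (s : τ) (i j : ℕ) : ℕ :=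
  ((Finset.Ico i j).filter fun t => X.ans F (X.run F s t) = true).card

/-- The contribution of one step to `weight`. -/
def factor (φ : Bool → ℝ) (F : Finset α) (s : τ) : ℝ :=
  if (X.ask s).isSome then φ (X.ans F s) else 1

/-- A product of functions of the answers. -/
def weight (φ : ℕ → Bool → ℝ) (F : Finset α) (s : τ) (m : ℕ) : ℝ :=
  ∏ t ∈ Finset.range m, X.factor (φ t) F (X.run F s t)

@[simp] lemma run_zero (F : Finset α) (s : τ) : X.run F s 0 = s := rfl

lemma run_succ (F : Finset α) (s : τ) (i : ℕ) :
    X.run F s (i + 1) = X.next (X.run F s i) (X.ans F (X.run F s i)) :=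
  Function.iterate_succ_apply' _ _ _

lemma run_succ' (F : Finset α) (s : τ) (i : ℕ) :
    X.run F s (i + 1) = X.run F (X.next s (X.ans F s)) i :=
  Function.iterate_succ_apply _ _ _

lemma weight_succ (φ : ℕ → Bool → ℝ) (F : Finset α) (s : τ) (m : ℕ) :
    X.weight φ F s (m + 1) =
      X.factor (φ 0) F s * X.weight (fun t => φ (t + 1)) F (X.next s (X.ans F s)) m := by
  unfold weight
  rw [Finset.prod_range_succ', mul_comm]
  simp only [run_succ', run_zero]

lemma ans_some {F : Finset α} {s : τ} {e : α} (h : X.ask s = some e) :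
    X.ans F s = decide (e ∈ F) := by simp [ans, h]

lemma ans_none {F : Finset α} {s : τ} (h : X.ask s = none) : X.ans F s = false := by
  simp [ans, h]

/-- The answers to an adaptive exploration are independent. -/
lemma bexp_mul_weight {p : ℝ} (m : ℕ) (φ : ℕ → Bool → ℝ)
    (hφ : ∀ t, p * φ t true + (1 - p) * φ t false = 1) (s : τ) (g : Finset α → ℝ)
    (hg : ∀ F e, e ∉ X.asked s → g (insert e F) = g F) :
    bexp E p (fun F => g F * X.weight φ F s m) = bexp E p g := by
  induction m generalizing φ s g with
  | zero => simp [weight]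
  | succ m ih =>
    simp only [weight_succ]
    rcases h : X.ask s with _ | e
    · simp only [factor, h, Option.isSome_none, Bool.false_eq_true, if_false, one_mul,
        X.ans_none h]
      exact ih _ (fun t => hφ _) _ _ (by rwa [X.asked_next_none _ h])
    · have key : ∀ b : Bool, bexp E p (fun F => ((if e ∈ F then (if b then 1 else 0) else
          (if b then 0 else 1)) * g F) * X.weight (fun t => φ (t + 1)) F (X.next s b) m) =
          bexp E p (fun F => (if e ∈ F then (if b then 1 else 0) else
          (if b then 0 else 1)) * g F) := fun b => by
        refine ih _ (fun t => hφ _) _ _ fun F e' he' => ?_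
        rw [X.asked_next_some _ h, Finset.mem_insert, not_or] at he'
        rw [hg _ _ he'.2]
        simp [Finset.mem_insert, Ne.symm he'.1]
      have he : ∀ F, g (insert e F) = g F := fun F => hg F e (X.notMem_of_ask h)
      have heq : bexp E p (fun F => g F * (X.factor (φ 0) F s *
          X.weight (fun t => φ (t + 1)) F (X.next s (X.ans F s)) m)) =
          φ 0 true * bexp E p (fun F => ((if e ∈ F then (if true then 1 else 0) else
            (if true then 0 else 1)) * g F) * X.weight (fun t => φ (t + 1)) F (X.next s true) m) +
          φ 0 false * bexp E p (fun F => ((if e ∈ F then (if false then 1 else 0) else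
            (if false then 0 else 1)) * g F) *
            X.weight (fun t => φ (t + 1)) F (X.next s false) m) := by
        rw [← bexp_mul_left, ← bexp_mul_left, ← bexp_add]
        refine bexp_congr fun F _ => ?_
        by_cases heF : e ∈ F <;> simp [factor, h, X.ans_some h, heF] <;> ring
      rw [heq, key, key, bexp_indep (X.mem_of_ask h) _ _ _ he,
        bexp_indep (X.mem_of_ask h) _ _ _ he]
      simp only [if_true, Bool.false_eq_true, if_false]
      linear_combination bexp E p g * hφ 0

/-- The second-order bound -log(1 - β) ≤ β + β²; its error term is the reason for the factor `1 + β`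
in `BadWindow`. -/
lemma exp_neg_le_one_sub {β : ℝ} (h0 : 0 ≤ β) (h1 : β ≤ 1 / 2) :
    Real.exp (-(β * (1 + β))) ≤ 1 - β := by
  rw [Real.exp_neg, inv_le_comm₀ (Real.exp_pos _) (by linarith)]
  refine le_trans ?_ (Real.quadratic_le_exp_of_nonneg (by positivity))
  rw [inv_le_iff_one_le_mul₀ (by linarith)]
  nlinarith [mul_nonneg h0 h0, mul_nonneg (mul_nonneg h0 h0) (by linarith : 0 ≤ 1 / 2 - β),
    mul_nonneg (mul_nonneg (mul_nonneg h0 h0) h0) (by linarith : 0 ≤ 1 / 2 - β),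
    mul_nonneg (mul_nonneg (mul_nonneg (mul_nonneg h0 h0) h0) h0) (by linarith : 0 ≤ 1 / 2 - β)]

/-- Between steps `i` and `j` many questions were asked, and few answers were positive. -/
def BadWindow (p β η : ℝ) (F : Finset α) (s : τ) (i j : ℕ) : Prop :=
  (1 + β) * X.positives F s i j + η ≤ p * X.queries F s i j

/-- Exponential tilting: `1 - p * β` is the mean of `1 - β` to the power of one answer, so each
factor has mean one. The factors before time `i` are switched off, which turns a product over all
steps up to `j` into one over the window. -/
lemma weight_window (p β : ℝ) (F : Finset α) (s : τ) {i j : ℕ} :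
    X.weight (fun t b => if i ≤ t then (if b then 1 - β else 1) / (1 - p * β) else 1) F s j =
      (1 - β) ^ X.positives F s i j / (1 - p * β) ^ X.queries F s i j := by
  have hsplit : X.weight (fun t b => if i ≤ t then (if b then 1 - β else 1) / (1 - p * β) else 1)
      F s j = (∏ t ∈ Finset.range j, if i ≤ t ∧ X.ans F (X.run F s t) = true then 1 - β else 1) /
        (∏ t ∈ Finset.range j, if i ≤ t ∧ (X.ask (X.run F s t)).isSome then 1 - p * β else 1) := by
    unfold weight
    rw [← Finset.prod_div_distrib]
    refine Finset.prod_congr rfl fun t _ => ?_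
    unfold factor
    rcases h : X.ask (X.run F s t) with _ | e
    · simp [X.ans_none h]
    · by_cases hi : i ≤ t <;> simp [hi]
  rw [hsplit, Finset.prod_ite, Finset.prod_ite]
  simp only [Finset.prod_const, one_pow, mul_one, positives, queries]
  congr 3 <;> ext t <;> simp only [Finset.mem_filter, Finset.mem_range, Finset.mem_Ico] <;> tauto

/-- Markov's inequality: the weight of `weight_window` has mean one, and on a bad window it is at
least exp(βη). -/
lemma bexp_badWindow_le {p β η : ℝ} (hp0 : 0 ≤ p) (hp1 : p ≤ 1) (hβ0 : 0 ≤ β) (hβ1 : β ≤ 1 / 2)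
    (s : τ) (i j : ℕ) :
    bexp E p (fun F => open Classical in if X.BadWindow p β η F s i j then 1 else 0) ≤
      Real.exp (-(β * η)) := by
  classical
  have hpβ : p * β ≤ 1 / 2 := by nlinarith
  set φ : ℕ → Bool → ℝ := fun t b => if i ≤ t then (if b then 1 - β else 1) / (1 - p * β) else 1
  have h1 : bexp E p (fun F => X.weight φ F s j) = 1 := by
    have := X.bexp_mul_weight (p := p) j φ ?_ s (fun _ => 1) (fun _ _ _ => rfl)
    · simpa [bexp_const] using this
    · intro t
      simp only [φ]
      by_cases hi : i ≤ t
      · have : (1 - p * β) ≠ 0 := by linarith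
        simp only [hi, if_true, Bool.false_eq_true, if_false]
        field_simp
        ring
      · simp [hi]
  calc _ ≤ bexp E p (fun F => Real.exp (-(β * η)) * X.weight φ F s j) := by
        refine bexp_mono hp0 hp1 fun F _ => ?_
        rw [X.weight_window]
        split_ifs with hb
        · unfold BadWindow at hb
          have e1 : Real.exp (-(β * (1 + β)) * X.positives F s i j) ≤
              (1 - β) ^ X.positives F s i j := by
            rw [mul_comm, Real.exp_nat_mul]
            exact pow_le_pow_left₀ (Real.exp_pos _).le (exp_neg_le_one_sub hβ0 hβ1) _
          have e2 : (1 - p * β) ^ X.queries F s i j ≤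
              Real.exp (-(p * β) * X.queries F s i j) := by
            rw [mul_comm (-(p * β)), Real.exp_nat_mul]
            exact pow_le_pow_left₀ (by linarith) (Real.one_sub_le_exp_neg _) _
          have e3 : 0 < (1 - p * β) ^ X.queries F s i j := pow_pos (by linarith) _
          rw [← mul_div_assoc, one_le_div e3]
          refine e2.trans (le_trans ?_ (mul_le_mul_of_nonneg_left e1 (Real.exp_pos _).le))
          rw [← Real.exp_add]
          refine Real.exp_le_exp.2 ?_
          nlinarith
        · have : 0 ≤ 1 - β := by linarith
          have : 0 ≤ 1 - p * β := by linarith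
          positivity
    _ = _ := by rw [bexp_mul_left, h1, mul_one]

lemma bexp_exists_badWindow_le {p β η : ℝ} (hp0 : 0 ≤ p) (hp1 : p ≤ 1) (hβ0 : 0 ≤ β)
    (hβ1 : β ≤ 1 / 2) (s : τ) (N : ℕ) :
    bexp E p (fun F => open Classical in
      if ∃ i j, i ≤ N ∧ j ≤ N ∧ X.BadWindow p β η F s i j then 1 else 0) ≤
      (N + 1) ^ 2 * Real.exp (-(β * η)) := by
  classical
  calc _ ≤ bexp E p (fun F => ∑ i ∈ Finset.range (N + 1), ∑ j ∈ Finset.range (N + 1),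
        if X.BadWindow p β η F s i j then (1 : ℝ) else 0) := by
        refine bexp_mono hp0 hp1 fun F _ => ?_
        split_ifs with h
        · obtain ⟨i, j, hi, hj, hb⟩ := h
          have nn : ∀ i j, (0 : ℝ) ≤ if X.BadWindow p β η F s i j then (1 : ℝ) else 0 :=
            fun i j => by split_ifs <;> norm_num
          refine le_trans ?_ (Finset.single_le_sum
            (fun i _ => Finset.sum_nonneg fun j _ => nn i j)
            (Finset.mem_range.2 (Nat.lt_succ_of_le hi)))
          refine le_trans ?_ (Finset.single_le_sum (fun j _ => nn i j)
            (Finset.mem_range.2 (Nat.lt_succ_of_le hj)))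
          simp [hb]
        · exact Finset.sum_nonneg fun i _ => Finset.sum_nonneg fun j _ => by
            split_ifs <;> norm_num
    _ = ∑ i ∈ Finset.range (N + 1), ∑ j ∈ Finset.range (N + 1),
        bexp E p (fun F => if X.BadWindow p β η F s i j then (1 : ℝ) else 0) := by
        rw [bexp_sum]
        exact Finset.sum_congr rfl fun i _ => bexp_sum _ _ _ _
    _ ≤ ∑ i ∈ Finset.range (N + 1), ∑ j ∈ Finset.range (N + 1), Real.exp (-(β * η)) :=
        Finset.sum_le_sum fun i _ => Finset.sum_le_sum fun j _ =>
          X.bexp_badWindow_le hp0 hp1 hβ0 hβ1 s i j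
    _ = _ := by simp [Finset.sum_const]; ring

end Exploration

end Exploration

/-! ### The law of the random subgraph as a finite sum -/

section Law

variable {V : Type*} [Fintype V]

open Classical in
lemma randomSubgraph_real_eq (G : SimpleGraph V) (p : I) (A : Set (SimpleGraph V)) :
    (randomSubgraph G p).real A =
      bexp G.edgeFinset (p : ℝ)
        (fun F => if SimpleGraph.fromEdgeSet (F : Set (Sym2 V)) ∈ A then 1 else 0) := by
  unfold randomSubgraph bexp
  have hA : MeasurableSet A := by
    have : (SimpleGraph.edgeSet '' A : Set (Set (Sym2 V))).Finite := Set.toFinite _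
    have h2 := SimpleGraph.measurable_edgeSet (V := V) this.measurableSet
    rwa [Set.preimage_image_eq _ SimpleGraph.edgeSet_injective] at h2
  rw [measureReal_def, Measure.map_apply SimpleGraph.measurable_fromEdgeSet hA,
    setBernoulli_apply_eq_apply_subsets, ← measureReal_def]
  have : {s | s ∈ SimpleGraph.fromEdgeSet ⁻¹' A ∧ s ⊆ G.edgeSet} =
      ⋃ F ∈ G.edgeFinset.powerset.filter
        (fun F : Finset (Sym2 V) => SimpleGraph.fromEdgeSet (F : Set (Sym2 V)) ∈ A),
          {(F : Set (Sym2 V))} := by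
    ext s
    simp only [Set.mem_preimage, Set.mem_ofPred_eq, Finset.mem_filter, Finset.mem_powerset,
      Set.mem_iUnion, Set.mem_singleton_iff, exists_prop]
    constructor
    · rintro ⟨h1, h2⟩
      refine ⟨s.toFinset, ⟨?_, ?_⟩, by simp⟩
      · intro e he
        simpa using h2 (by simpa using he)
      · simpa using h1
    · rintro ⟨F, ⟨h1, h2⟩, rfl⟩
      exact ⟨h2, fun e he => by simpa using h1 (by simpa using he)⟩
  rw [this, measureReal_biUnion_finset]
  · rw [Finset.sum_filter]
    refine Finset.sum_congr rfl fun F hF => ?_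
    have hF' := Finset.mem_powerset.1 hF
    have hsub : (F : Set (Sym2 V)) ⊆ G.edgeSet := fun e he => by simpa using hF' (by simpa using he)
    by_cases hFA : SimpleGraph.fromEdgeSet (F : Set (Sym2 V)) ∈ A
    · simp only [hFA, if_true]
      rw [setBernoulli_real_singleton p hsub (Set.toFinite _), Set.ncard_coe_finset,
        Set.ncard_sdiff hsub, Set.ncard_coe_finset, ← SimpleGraph.coe_edgeFinset,
        Set.ncard_coe_finset, mul_one]
    · simp [hFA]
  · intro F _ F' _ hne
    simpa using fun h => hne (by exact_mod_cast h)
  · intro F _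
    exact measurableSet_singleton _

end Law

end Percolation

namespace Percolation

/-! ### Depth first search in the random graph -/

section DepthFirstSearch

variable {V : Type*} [DecidableEq V]

/-- The state of a depth first search: the stack, the vertices not yet seen, and the edges of which
it is known whether they belong to the random graph. -/
@[ext]
structure DFSState (V : Type*) where
  /-- the path from the root of the current tree to the current vertex, which comes first -/
  stack : List V
  /-- the vertices not yet discovered -/
  unseen : Finset V
  /-- the edges already asked about -/
  asked : Finset (Sym2 V)

namespace DFSState

variable (G : SimpleGraph V)

/-- The next pair to be asked: the current vertex, and an unseen neighbour of it. -/
noncomputable def query (s : DFSState V) : Option (V × V) :=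
  open Classical in
  match s.stack with
  | [] => none
  | u :: _ =>
    if h : ∃ y ∈ s.unseen, G.Adj u y ∧ s(u, y) ∉ s.asked then some (u, h.choose) else none

/-- One step of depth first search. -/
noncomputable def next (s : DFSState V) (b : Bool) : DFSState V :=
  open Classical in
  match s.query G with
  | some (u, y) =>
    if b then ⟨y :: s.stack, s.unseen.erase y, insert s(u, y) s.asked⟩
    else ⟨s.stack, s.unseen, insert s(u, y) s.asked⟩
  | none =>
    match s.stack with
    | _ :: t => ⟨t, s.unseen, s.asked⟩
    | [] => if h : s.unseen.Nonempty then ⟨[h.choose], s.unseen.erase h.choose, s.asked⟩ else s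

variable {G}

lemma query_eq_some {s : DFSState V} {u y : V} (h : s.query G = some (u, y)) :
    (∃ t, s.stack = u :: t) ∧ y ∈ s.unseen ∧ G.Adj u y ∧ s(u, y) ∉ s.asked := by
  unfold query at h
  split at h
  · simp at h
  · rename_i v t hs
    split_ifs at h with hex
    simp only [Option.some.injEq, Prod.mk.injEq] at h
    obtain ⟨rfl, rfl⟩ := h
    exact ⟨⟨t, hs⟩, hex.choose_spec⟩

lemma query_eq_none {s : DFSState V} (h : s.query G = none) {u : V} {t : List V}
    (hs : s.stack = u :: t) {y : V} (hy : y ∈ s.unseen) (hadj : G.Adj u y) :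
    s(u, y) ∈ s.asked := by
  unfold query at h
  rw [hs] at h
  simp only at h
  split_ifs at h with hex
  by_contra hc
  exact hex ⟨y, hy, hadj, hc⟩

/-- The possible steps of a depth first search in the random graph with edge set `F`. -/
inductive Step (G : SimpleGraph V) (F : Finset (Sym2 V)) : DFSState V → DFSState V → Prop
  | push {u y : V} {t : List V} {U : Finset V} {A : Finset (Sym2 V)} (hy : y ∈ U)
      (hadj : G.Adj u y) (hA : s(u, y) ∉ A) (hF : s(u, y) ∈ F) :
      Step G F ⟨u :: t, U, A⟩ ⟨y :: u :: t, U.erase y, insert s(u, y) A⟩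
  | reject {u y : V} {t : List V} {U : Finset V} {A : Finset (Sym2 V)} (hy : y ∈ U)
      (hadj : G.Adj u y) (hA : s(u, y) ∉ A) (hF : s(u, y) ∉ F) :
      Step G F ⟨u :: t, U, A⟩ ⟨u :: t, U, insert s(u, y) A⟩
  | pop {u : V} {t : List V} {U : Finset V} {A : Finset (Sym2 V)}
      (h : ∀ y ∈ U, G.Adj u y → s(u, y) ∈ A) : Step G F ⟨u :: t, U, A⟩ ⟨t, U, A⟩
  | root {y : V} {U : Finset V} {A : Finset (Sym2 V)} (hy : y ∈ U) :
      Step G F ⟨[], U, A⟩ ⟨[y], U.erase y, A⟩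
  | done {A : Finset (Sym2 V)} : Step G F ⟨[], ∅, A⟩ ⟨[], ∅, A⟩

lemma Step.unseen_subset {F : Finset (Sym2 V)} {s s' : DFSState V} (h : Step G F s s') :
    s'.unseen ⊆ s.unseen := by
  cases h <;> simp [Finset.erase_subset]

end DFSState

omit [DecidableEq V] in
/-- Extend a path outside `U` by a chain in `U`. -/
lemma exists_path_of_isChain {H : SimpleGraph V} {U : Finset V} {z y : V} (q : H.Walk z y)
    (hq : q.IsPath) (hqU : ∀ v ∈ q.support, v ∉ U) (rest : List V) :
    ∀ (A : List V) (x : V), (x :: A ++ z :: rest).IsChain H.Adj → (x :: A).Nodup →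
      (∀ a ∈ x :: A, a ∈ U) → ∃ w : H.Walk x y, w.IsPath ∧ A.length + 1 ≤ w.length ∧
        ∀ v ∈ w.support, v ∈ U → v ∈ x :: A := by
  intro A
  induction A with
  | nil =>
    intro x hc hn hU
    have hxz : H.Adj x z := by
      simp only [List.cons_append, List.nil_append] at hc
      exact (List.isChain_cons_cons.1 hc).1
    refine ⟨.cons hxz q, (SimpleGraph.Walk.cons_isPath_iff hxz q).2
      ⟨hq, fun h => hqU x h (hU x (by simp))⟩, by simp, fun v hv hvU => ?_⟩
    rw [SimpleGraph.Walk.support_cons, List.mem_cons] at hv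
    rcases hv with rfl | hv
    · simp
    · exact absurd hvU (hqU v hv)
  | cons b A ih =>
    intro x hc hn hU
    simp only [List.cons_append] at hc
    obtain ⟨hxb, hc'⟩ := List.isChain_cons_cons.1 hc
    obtain ⟨w, hw, hlen, hsup⟩ := ih b (by simpa using hc') (List.nodup_cons.1 hn).2
      fun a ha => hU a (List.mem_cons_of_mem _ ha)
    refine ⟨.cons hxb w, (SimpleGraph.Walk.cons_isPath_iff hxb w).2 ⟨hw, fun h => ?_⟩,
      by simp; omega, fun v hv hvU => ?_⟩
    · exact (List.nodup_cons.1 hn).1 (hsup x h (hU x (by simp)))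
    · rw [SimpleGraph.Walk.support_cons, List.mem_cons] at hv
      rcases hv with rfl | hv
      · simp
      · exact List.mem_cons_of_mem _ (hsup v hv hvU)

variable (G : SimpleGraph V) [Fintype G.edgeSet]

/-- Depth first search as an adaptive exploration of the random edge set. -/
noncomputable def dfs : Exploration (Sym2 V) (DFSState V) G.edgeFinset where
  ask s := (s.query G).map fun x => s(x.1, x.2)
  next := DFSState.next G
  asked := DFSState.asked
  mem_of_ask {s e} h := by
    obtain ⟨⟨u, y⟩, h1, rfl⟩ := Option.map_eq_some_iff.1 h
    simpa using (DFSState.query_eq_some h1).2.2.1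
  notMem_of_ask {s e} h := by
    obtain ⟨⟨u, y⟩, h1, rfl⟩ := Option.map_eq_some_iff.1 h
    exact (DFSState.query_eq_some h1).2.2.2
  asked_next_some {s e} b h := by
    obtain ⟨⟨u, y⟩, h1, rfl⟩ := Option.map_eq_some_iff.1 h
    cases b <;> simp [DFSState.next, h1]
  asked_next_none {s} b h := by
    have h1 : s.query G = none := by simpa using h
    unfold DFSState.next
    rw [h1]
    simp only
    split
    · rfl
    · split_ifs <;> rfl

/-- The state of the depth first search in the random graph with edge set `F`, started with the
vertices of `U` unseen and all other vertices ignored. -/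
noncomputable def dfsState (F : Finset (Sym2 V)) (U : Finset V) (i : ℕ) : DFSState V :=
  (dfs G).run F ⟨[], U, ∅⟩ i

variable {G}

lemma dfs_step (F : Finset (Sym2 V)) (s : DFSState V) :
    DFSState.Step G F s ((dfs G).next s ((dfs G).ans F s)) := by
  rcases hq : s.query G with _ | ⟨u, y⟩
  · have hn : (dfs G).ask s = none := by simp [dfs, hq]
    rw [Exploration.ans_none _ hn]
    change DFSState.Step G F s (DFSState.next G s false)
    unfold DFSState.next
    rw [hq]
    obtain ⟨st, U, A⟩ := s
    rcases st with _ | ⟨u, t⟩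
    · simp only
      split_ifs with h
      · exact .root h.choose_spec
      · rw [Finset.not_nonempty_iff_eq_empty.1 h]
        exact .done
    · exact .pop fun y hy hadj => DFSState.query_eq_none hq rfl hy hadj
  · have hn : (dfs G).ask s = some s(u, y) := by simp [dfs, hq]
    rw [Exploration.ans_some _ hn]
    change DFSState.Step G F s (DFSState.next G s _)
    obtain ⟨⟨t, ht⟩, hy, hadj, hA⟩ := DFSState.query_eq_some hq
    unfold DFSState.next
    rw [hq]
    obtain ⟨st, U, A⟩ := s
    obtain rfl : st = u :: t := ht
    by_cases hF : s(u, y) ∈ F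
    · simpa [hF] using DFSState.Step.push hy hadj hA hF
    · simpa [hF] using DFSState.Step.reject hy hadj hA hF

variable (F : Finset (Sym2 V)) (U : Finset V)

@[simp] lemma dfsState_zero : dfsState G F U 0 = ⟨[], U, ∅⟩ := rfl

lemma dfsState_step (i : ℕ) :
    DFSState.Step G F (dfsState G F U i) (dfsState G F U (i + 1)) := by
  unfold dfsState
  rw [Exploration.run_succ]
  exact dfs_step F _

lemma dfsState_induction {P : ℕ → DFSState V → Prop} {l : ℕ} (h0 : P l (dfsState G F U l))
    (hs : ∀ i s s', l ≤ i → s = dfsState G F U i → s' = dfsState G F U (i + 1) →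
      DFSState.Step G F s s' → P i s → P (i + 1) s') {i : ℕ} (hi : l ≤ i) :
    P i (dfsState G F U i) := by
  induction i, hi using Nat.le_induction with
  | base => exact h0
  | succ i hi ih => exact hs i _ _ hi rfl rfl (dfsState_step F U i) ih

lemma unseen_anti {i j : ℕ} (hij : i ≤ j) :
    (dfsState G F U j).unseen ⊆ (dfsState G F U i).unseen :=
  dfsState_induction F U (P := fun _ s => s.unseen ⊆ (dfsState G F U i).unseen)
    (Finset.Subset.refl _) (fun _ _ _ _ _ _ h ih => h.unseen_subset.trans ih) hij

lemma unseen_subset (i : ℕ) : (dfsState G F U i).unseen ⊆ U := unseen_anti F U (Nat.zero_le i)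

lemma stack_unseen (i : ℕ) : (dfsState G F U i).stack.Nodup ∧
    ∀ v ∈ (dfsState G F U i).stack, v ∈ U ∧ v ∉ (dfsState G F U i).unseen := by
  refine dfsState_induction F U (P := fun _ s => s.stack.Nodup ∧ ∀ v ∈ s.stack, v ∈ U ∧ v ∉ s.unseen)
    (by simp) (fun i s s' _ hs _ h ih => ?_) (Nat.zero_le i)
  have hU : s.unseen ⊆ U := by rw [hs]; exact unseen_subset F U i
  cases h with
  | push hy hadj hA hF =>
    simp only at ih hU ⊢
    refine ⟨List.nodup_cons.2 ⟨fun h => (ih.2 _ h).2 hy, ih.1⟩, fun v hv => ?_⟩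
    rcases List.mem_cons.1 hv with rfl | hv
    · exact ⟨hU hy, Finset.notMem_erase _ _⟩
    · exact ⟨(ih.2 v hv).1, fun h => (ih.2 v hv).2 (Finset.mem_of_mem_erase h)⟩
  | reject => exact ih
  | pop => exact ⟨(List.nodup_cons.1 ih.1).2, fun v hv => ih.2 v (List.mem_cons_of_mem _ hv)⟩
  | root hy =>
    simp only at hU ⊢
    refine ⟨List.nodup_singleton _, fun v hv => ?_⟩
    rw [List.mem_singleton.1 hv]
    exact ⟨hU hy, Finset.notMem_erase _ _⟩
  | done => exact ih

lemma stack_isChain (i : ℕ) :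
    (dfsState G F U i).stack.IsChain (SimpleGraph.fromEdgeSet (F : Set (Sym2 V))).Adj := by
  refine dfsState_induction F U (P := fun _ s => s.stack.IsChain
    (SimpleGraph.fromEdgeSet (F : Set (Sym2 V))).Adj)
    (by simp) (fun i s s' _ hs _ h ih => ?_) (Nat.zero_le i)
  cases h with
  | push hy hadj hA hF =>
    refine List.isChain_cons_cons.2 ⟨?_, ih⟩
    rw [SimpleGraph.fromEdgeSet_adj, Sym2.eq_swap]
    exact ⟨hF, hadj.ne'⟩
  | reject => exact ih
  | pop => exact ih.tail
  | root hy => simp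
  | done => exact ih

/-- All edges between processed and unseen vertices have been asked. -/
lemma mem_asked (i : ℕ) {x y : V} (hxU : x ∈ U) (hx : x ∉ (dfsState G F U i).unseen)
    (hx' : x ∉ (dfsState G F U i).stack) (hy : y ∈ (dfsState G F U i).unseen)
    (hadj : G.Adj x y) : s(x, y) ∈ (dfsState G F U i).asked := by
  refine dfsState_induction F U (P := fun _ s => ∀ x ∈ U, x ∉ s.unseen → x ∉ s.stack →
    ∀ y ∈ s.unseen, G.Adj x y → s(x, y) ∈ s.asked)
    (by simp +contextual) (fun i s s' _ hs _ h ih => ?_) (Nat.zero_le i) x hxU hx hx' y hy hadj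
  intro x hxU hx hx' y hy hxy
  cases h with
  | push hy' hadj hA hF =>
    simp only [Finset.mem_erase, not_and, List.mem_cons, not_or] at hx hx' hy ih ⊢
    exact Finset.mem_insert_of_mem
      (ih x hxU (hx hx'.1) (by simpa using hx'.2) y hy.2 hxy)
  | reject => exact Finset.mem_insert_of_mem (ih x hxU hx hx' y hy hxy)
  | @pop u t U' A h =>
    simp only at hx hx' hy ih ⊢
    by_cases hxu : x = u
    · exact hxu ▸ h y hy (hxu ▸ hxy)
    · exact ih x hxU hx (by simp [hxu, hx']) y hy hxy
  | root hy' =>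
    simp only [Finset.mem_erase, not_and, List.mem_singleton] at hx hx' hy ih ⊢
    exact ih x hxU (hx hx') (by simp) y hy.2 hxy
  | done => exact ih x hxU hx hx' _ hy hxy

/-- An edge asked about has an end that has been seen. -/
lemma notMem_asked (i : ℕ) {x y : V} (hx : x ∈ (dfsState G F U i).unseen)
    (hy : y ∈ (dfsState G F U i).unseen) : s(x, y) ∉ (dfsState G F U i).asked := by
  refine dfsState_induction F U (P := fun i s => s = dfsState G F U i ∧
    ∀ x ∈ s.unseen, ∀ y ∈ s.unseen, s(x, y) ∉ s.asked)
    ⟨rfl, by simp⟩ (fun i s s' _ hs hs' h ih => ⟨hs', ?_⟩) (Nat.zero_le i) |>.2 x hx y hy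
  replace ih := ih.2
  have hst : ∀ v ∈ s.stack, v ∉ s.unseen := by
    rw [hs]; exact fun v hv => ((stack_unseen F U i).2 v hv).2
  intro x hx y hy
  have key : ∀ u w : V, u ∉ s.unseen → x ∈ s.unseen → y ∈ s.unseen → s(x, y) ≠ s(u, w) := by
    intro u w hu hx hy heq
    rcases Sym2.eq_iff.1 heq with ⟨rfl, -⟩ | ⟨-, rfl⟩
    · exact hu hx
    · exact hu hy
  cases h with
  | @push u w t U' A hy' hadj hA hF =>
    simp only at hx hy ih key hst ⊢
    have hx1 := Finset.mem_of_mem_erase hx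
    have hy1 := Finset.mem_of_mem_erase hy
    rw [Finset.mem_insert, not_or]
    exact ⟨key u w (hst u (by simp)) hx1 hy1, ih x hx1 y hy1⟩
  | @reject u w t U' A hy' hadj hA hF =>
    simp only at hx hy ih key hst ⊢
    rw [Finset.mem_insert, not_or]
    exact ⟨key u w (hst u (by simp)) hx hy, ih x hx y hy⟩
  | pop => exact ih x hx y hy
  | root hy' => exact ih x (Finset.mem_of_mem_erase hx) y (Finset.mem_of_mem_erase hy)
  | done => exact ih x hx y hy

/-- As long as the stack does not get shorter than it is at time `l`, it is extended by vertices
unseen at time `l`. -/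
lemma exists_stack_eq_append {l i : ℕ} (hli : l ≤ i)
    (h : ∀ t, l ≤ t → t ≤ i → (dfsState G F U l).stack.length ≤ (dfsState G F U t).stack.length) :
    ∃ A, (dfsState G F U i).stack = A ++ (dfsState G F U l).stack ∧
      ∀ a ∈ A, a ∈ (dfsState G F U l).unseen := by
  induction i, hli using Nat.le_induction with
  | base => exact ⟨[], by simp⟩
  | succ i hi ih =>
    obtain ⟨A, hA, hAU⟩ := ih fun t h1 h2 => h t h1 (by omega)
    have hlen := h (i + 1) (by omega) le_rfl
    have hun : (dfsState G F U i).unseen ⊆ (dfsState G F U l).unseen := unseen_anti F U hi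
    have hstep := dfsState_step (G := G) F U i
    revert hlen hun hA hstep
    generalize dfsState G F U (i + 1) = s'
    generalize dfsState G F U i = s
    intro hA hlen hun hstep
    cases hstep with
    | @push u y t U' A' hy =>
      simp only at hA hun ⊢
      exact ⟨y :: A, by rw [hA]; rfl, by
        intro a ha
        rcases List.mem_cons.1 ha with rfl | ha
        · exact hun hy
        · exact hAU a ha⟩
    | reject => exact ⟨A, hA, hAU⟩
    | @pop u t U' A' =>
      simp only at hA hun hlen ⊢
      rcases A with _ | ⟨a, A⟩
      · simp only [List.nil_append] at hA
        rw [← hA] at hlen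
        simp at hlen
      · simp only [List.cons_append, List.cons.injEq] at hA
        exact ⟨A, hA.2, fun a ha => hAU a (List.mem_cons_of_mem _ ha)⟩
    | @root y U' A' hy =>
      simp only at hA hun ⊢
      have h0 := List.append_eq_nil_iff.1 hA.symm
      exact ⟨[y], by simp [h0.2], by simpa using hun hy⟩
    | done => exact ⟨A, hA, hAU⟩

/-- All vertices seen since the stack was empty for the last time are connected to the current
vertex. -/
lemma exists_walk_of_seen {r l : ℕ} (hrl : r ≤ l)
    (h : ∀ t, r < t → t ≤ l → (dfsState G F U t).stack ≠ []) {z : V} {rest : List V}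
    (hz : (dfsState G F U l).stack = z :: rest) {y : V} (hy : y ∈ (dfsState G F U r).unseen)
    (hy' : y ∉ (dfsState G F U l).unseen) :
    ∃ w : (SimpleGraph.fromEdgeSet (F : Set (Sym2 V))).Walk z y,
      ∀ v ∈ w.support, v ∉ (dfsState G F U l).unseen := by
  induction l, hrl using Nat.le_induction generalizing z rest with
  | base => exact absurd hy hy'
  | succ l hl ih =>
    have hne : r < l → (dfsState G F U l).stack ≠ [] := fun hrl => h l hrl (by omega)
    have ih' := fun (z : V) (rest : List V) => @ih (fun t h1 h2 => h t h1 (by omega)) z rest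
    have hst := (stack_unseen (G := G) F U l).2
    have hch := stack_isChain (G := G) F U l
    -- An empty stack is possible only at time `r` itself, so a new root is the first vertex seen
    -- after `r`.
    have hlr : (dfsState G F U l).stack = [] →
        (dfsState G F U l).unseen = (dfsState G F U r).unseen := fun h0 => by
      rcases hl.eq_or_lt with rfl | hlt
      · rfl
      · exact absurd h0 (hne hlt)
    have hstep := dfsState_step (G := G) F U l
    clear ih
    revert hz hy' ih' hst hstep hlr hch
    generalize dfsState G F U (l + 1) = s'
    generalize dfsState G F U l = s
    intro hz hy' ih' hst hch hlr hstep
    cases hstep with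
    | @push u x t U' A' hx hadj hA hF =>
      simp only [List.cons.injEq] at hz ih' hy' hst ⊢
      obtain ⟨rfl, -⟩ := hz
      have hux : (SimpleGraph.fromEdgeSet (F : Set (Sym2 V))).Adj x u := by
        rw [SimpleGraph.fromEdgeSet_adj, Sym2.eq_swap]
        exact ⟨hF, hadj.ne'⟩
      by_cases hyx : y = x
      · subst hyx
        exact ⟨.nil, by simp⟩
      · have : y ∉ U' := fun h => hy' (Finset.mem_erase.2 ⟨hyx, h⟩)
        obtain ⟨w, hw⟩ := ih' u t ⟨rfl, rfl⟩ this
        refine ⟨.cons hux w, fun v hv => ?_⟩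
        rw [SimpleGraph.Walk.support_cons, List.mem_cons] at hv
        rcases hv with rfl | hv
        · exact Finset.notMem_erase _ _
        · exact fun h => hw v hv (Finset.mem_of_mem_erase h)
    | reject => exact ih' z rest hz hy'
    | @pop u t U' A' hpop =>
      simp only at hz ih' hy' hst hch ⊢
      subst hz
      obtain ⟨w, hw⟩ := ih' u _ rfl hy'
      refine ⟨.cons (List.isChain_cons_cons.1 hch).1.symm w, fun v hv => ?_⟩
      rw [SimpleGraph.Walk.support_cons, List.mem_cons] at hv
      rcases hv with rfl | hv
      · exact (hst _ (by simp)).2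
      · exact hw v hv
    | @root x U' A' hx =>
      simp only [List.cons.injEq] at hz hy' hlr ⊢
      obtain ⟨rfl, -⟩ := hz
      have hyx : y = x := by
        by_contra hne
        exact hy' (Finset.mem_erase.2 ⟨hne, by rw [hlr trivial]; exact hy⟩)
      subst hyx
      exact ⟨.nil, by simp⟩
    | done => simp at hz

/-- There is a long path between a vertex seen before time `l` and a vertex at the top of a stack
that is much longer than at time `l`. -/
lemma exists_long_path {r l i : ℕ} (hrl : r ≤ l)
    (h : ∀ t, r < t → t ≤ l → (dfsState G F U t).stack ≠ []) (hl : (dfsState G F U l).stack ≠ [])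
    {y : V} (hy : y ∈ (dfsState G F U r).unseen) (hy' : y ∉ (dfsState G F U l).unseen)
    (hli : l ≤ i) (hlen : ∀ t, l ≤ t → t ≤ i →
      (dfsState G F U l).stack.length ≤ (dfsState G F U t).stack.length)
    {x : V} {rest : List V} (hx : (dfsState G F U i).stack = x :: rest)
    (hlt : (dfsState G F U l).stack.length < (dfsState G F U i).stack.length) :
    ∃ w : (SimpleGraph.fromEdgeSet (F : Set (Sym2 V))).Walk x y, w.IsPath ∧
      (dfsState G F U i).stack.length ≤ (dfsState G F U l).stack.length + w.length := by
  obtain ⟨z, rest', hz⟩ := List.exists_cons_of_ne_nil hl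
  obtain ⟨w, hw⟩ := exists_walk_of_seen F U hrl h hz hy hy'
  obtain ⟨A, hA, hAU⟩ := exists_stack_eq_append F U hli hlen
  have hch := stack_isChain (G := G) F U i
  have hnd := (stack_unseen (G := G) F U i).1
  rcases A with _ | ⟨a, A⟩
  · rw [hA] at hlt
    simp at hlt
  · obtain rfl : x = a := by
      rw [hx] at hA
      simpa using (List.cons.inj hA).1
    rw [hA, hz] at hch
    rw [hA] at hnd
    -- `w` stays among vertices seen by time `l`, while the newer part of the stack consists of
    -- vertices unseen then. The two are disjoint and can be joined to a path.
    obtain ⟨w', h1, h2, -⟩ := exists_path_of_isChain w.bypass w.bypass_isPath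
      (fun v hv => hw v (w.support_bypass_subset_support hv)) rest' A x hch
      (List.Nodup.of_append_left hnd) hAU
    exact ⟨w', h1, by rw [hA]; simp; omega⟩

/-- A vertex is at the top of the stack when it is discovered. -/
lemma exists_discovery {l j : ℕ} (hlj : l ≤ j) {x : V} (hx : x ∈ (dfsState G F U l).unseen)
    (hx' : x ∉ (dfsState G F U j).unseen) :
    ∃ i rest, l < i ∧ i ≤ j ∧ (dfsState G F U i).stack = x :: rest := by
  induction j, hlj using Nat.le_induction with
  | base => exact absurd hx hx'
  | succ j hj ih =>
    by_cases hxj : x ∈ (dfsState G F U j).unseen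
    · refine ⟨j + 1, ?_⟩
      have hstep := dfsState_step (G := G) F U j
      revert hx' hxj hstep
      generalize dfsState G F U (j + 1) = s'
      generalize dfsState G F U j = s
      intro hx' hxj hstep
      have aux : ∀ {y : V} {U' : Finset V}, x ∈ U' → x ∉ U'.erase y → y = x := by
        intro y U' h1 h2
        by_contra hne
        exact h2 (Finset.mem_erase.2 ⟨Ne.symm hne, h1⟩)
      cases hstep with
      | @push u y t U' A' hy => exact ⟨u :: t, by omega, le_rfl, by simp [aux hxj hx']⟩
      | reject => exact absurd hxj hx'
      | pop => exact absurd hxj hx'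
      | root hy => exact ⟨[], by omega, le_rfl, by simp [aux hxj hx']⟩
      | done => exact absurd hxj hx'
    · obtain ⟨i, rest, h1, h2, h3⟩ := ih hxj
      exact ⟨i, rest, h1, by omega, h3⟩

lemma length_stack_succ (i : ℕ) :
    (dfsState G F U (i + 1)).stack.length ≤ (dfsState G F U i).stack.length + 1 ∧
      (dfsState G F U i).stack.length ≤ (dfsState G F U (i + 1)).stack.length + 1 := by
  have hstep := dfsState_step (G := G) F U i
  revert hstep
  generalize dfsState G F U (i + 1) = s'
  generalize dfsState G F U i = s
  intro hstep
  cases hstep <;> simp only [List.length_cons, List.length_nil] <;> omega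

lemma card_unseen_succ (i : ℕ) :
    (dfsState G F U i).unseen.card ≤ (dfsState G F U (i + 1)).unseen.card + 1 := by
  have hstep := dfsState_step (G := G) F U i
  revert hstep
  generalize dfsState G F U (i + 1) = s'
  generalize dfsState G F U i = s
  intro hstep
  cases hstep with
  | push hy => simp only [Finset.card_erase_of_mem hy]; omega
  | root hy => simp only [Finset.card_erase_of_mem hy]; omega
  | _ => simp

/-- Each positive answer discovers one vertex. Equality may fail because roots are discovered
without a question. -/
lemma unseen_card_add_positives {i j : ℕ} (hij : i ≤ j) :
    (dfsState G F U j).unseen.card + (dfs G).positives F ⟨[], U, ∅⟩ i j ≤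
      (dfsState G F U i).unseen.card := by
  induction j, hij using Nat.le_induction with
  | base => simp [Exploration.positives]
  | succ j hj ih =>
    have hpos : (dfs G).positives F ⟨[], U, ∅⟩ i (j + 1) = (dfs G).positives F ⟨[], U, ∅⟩ i j +
        if (dfs G).ans F (dfsState G F U j) = true then 1 else 0 := by
      unfold Exploration.positives
      rw [← Finset.insert_Ico_right_eq_Ico_add_one hj, Finset.filter_insert]
      split_ifs with h1 h2 h2
      · rw [Finset.card_insert_of_notMem (by simp)]
      · exact absurd h1 h2
      · exact absurd h2 h1
      · rfl
    rw [hpos]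
    split_ifs with hans
    · have : (dfsState G F U (j + 1)).unseen.card + 1 ≤ (dfsState G F U j).unseen.card := by
        have hrun : dfsState G F U (j + 1) = DFSState.next G (dfsState G F U j) true := by
          conv_lhs => unfold dfsState
          rw [Exploration.run_succ]
          change DFSState.next G _ ((dfs G).ans F (dfsState G F U j)) = _
          rw [hans]
          rfl
        rcases hq : (dfsState G F U j).query G with _ | ⟨u, y⟩
        · rw [Exploration.ans_none _ (by simp [dfs, hq])] at hans
          simp at hans
        · rw [hrun]
          unfold DFSState.next
          rw [hq]
          simp only [if_true]
          rw [Finset.card_erase_add_one (DFSState.query_eq_some hq).2.1]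
      omega
    · have := Finset.card_le_card (unseen_anti (G := G) F U (Nat.le_succ j))
      simp only [Nat.succ_eq_add_one] at this
      omega

lemma asked_mono {i j : ℕ} (hij : i ≤ j) :
    (dfsState G F U i).asked ⊆ (dfsState G F U j).asked := by
  refine dfsState_induction F U (P := fun _ s => (dfsState G F U i).asked ⊆ s.asked)
    (Finset.Subset.refl _) (fun _ s s' _ _ _ h ih => ?_) hij
  cases h with
  | push => exact ih.trans (Finset.subset_insert _ _)
  | reject => exact ih.trans (Finset.subset_insert _ _)
  | _ => exact ih

lemma card_asked_eq {i j : ℕ} (hij : i ≤ j) : (dfsState G F U j).asked.card =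
    (dfsState G F U i).asked.card + (dfs G).queries F ⟨[], U, ∅⟩ i j := by
  induction j, hij using Nat.le_induction with
  | base => simp [Exploration.queries]
  | succ j hj ih =>
    have hq : (dfs G).queries F ⟨[], U, ∅⟩ i (j + 1) = (dfs G).queries F ⟨[], U, ∅⟩ i j +
        if ((dfs G).ask (dfsState G F U j)).isSome then 1 else 0 := by
      unfold Exploration.queries
      rw [← Finset.insert_Ico_right_eq_Ico_add_one hj, Finset.filter_insert]
      split_ifs with h1 h2 h2
      · rw [Finset.card_insert_of_notMem (by simp)]
      · exact absurd h1 h2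
      · exact absurd h2 h1
      · rfl
    have hrun : dfsState G F U (j + 1) =
        (dfs G).next (dfsState G F U j) ((dfs G).ans F (dfsState G F U j)) := by
      conv_lhs => unfold dfsState
      rw [Exploration.run_succ]
      rfl
    rw [hq, ← add_assoc, ← ih, hrun]
    rcases h : (dfs G).ask (dfsState G F U j) with _ | e
    · simp only [Option.isSome_none, Bool.false_eq_true, if_false, add_zero]
      exact congrArg Finset.card ((dfs G).asked_next_none _ h)
    · have h1 := (dfs G).asked_next_some ((dfs G).ans F (dfsState G F U j)) h
      have h2 := (dfs G).notMem_of_ask h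
      simp only [Option.isSome_some, if_true]
      exact (congrArg Finset.card h1).trans (Finset.card_insert_of_notMem h2)

lemma card_asked_sdiff {i j : ℕ} (hij : i ≤ j) :
    ((dfsState G F U j).asked \ (dfsState G F U i).asked).card =
      (dfs G).queries F ⟨[], U, ∅⟩ i j := by
  rw [Finset.card_sdiff_of_subset (asked_mono F U hij), card_asked_eq F U hij]
  omega

lemma asked_subset (i : ℕ) : (dfsState G F U i).asked ⊆ G.edgeFinset := by
  refine dfsState_induction F U (P := fun _ s => s.asked ⊆ G.edgeFinset)
    (by simp) (fun _ s s' _ _ _ h ih => ?_) (Nat.zero_le i)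
  cases h with
  | push hy hadj => exact Finset.insert_subset (by simpa using hadj) ih
  | reject hy hadj => exact Finset.insert_subset (by simpa using hadj) ih
  | _ => exact ih

/-- The search ends. -/
lemma dfsState_end {i : ℕ} (hi : 2 * U.card + G.edgeFinset.card ≤ i) :
    (dfsState G F U i).stack = [] ∧ (dfsState G F U i).unseen = ∅ := by
  -- Time is charged to its causes: a vertex pays for entering and for leaving the stack, and every
  -- rejection uses a new question.
  have key : ∀ i, ((dfsState G F U i).stack = [] ∧ (dfsState G F U i).unseen = ∅) ∨
      i + (dfsState G F U i).stack.length + 2 * (dfsState G F U i).unseen.card ≤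
        2 * U.card + (dfsState G F U i).asked.card := by
    intro i
    refine dfsState_induction F U (P := fun i s => (s.stack = [] ∧ s.unseen = ∅) ∨
      i + s.stack.length + 2 * s.unseen.card ≤ 2 * U.card + s.asked.card)
      (by simp) (fun i s s' _ _ _ h ih => ?_) (Nat.zero_le i)
    cases h with
    | push hy hadj hA =>
      right
      simp only [reduceCtorEq, false_and, false_or, List.length_cons] at ih ⊢
      rw [Finset.card_insert_of_notMem hA, Finset.card_erase_of_mem hy]
      have := Finset.card_pos.2 ⟨_, hy⟩
      omega
    | reject hy hadj hA =>
      right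
      simp only [reduceCtorEq, false_and, false_or, List.length_cons] at ih ⊢
      rw [Finset.card_insert_of_notMem hA]
      omega
    | pop =>
      right
      simp only [reduceCtorEq, false_and, false_or, List.length_cons] at ih ⊢
      omega
    | root hy =>
      right
      simp only [true_and, List.length_nil, List.length_cons] at ih ⊢
      rw [Finset.card_erase_of_mem hy]
      have := Finset.card_pos.2 ⟨_, hy⟩
      rcases ih with ih | ih
      · simp [ih] at this
      · omega
    | done => simp
  rcases key i with h | h
  · exact h
  · have h1 := Finset.card_le_card (asked_subset (G := G) F U i)
    have h2 : (dfsState G F U i).stack.length = 0 := by omega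
    have h3 : (dfsState G F U i).unseen.card = 0 := by omega
    exact ⟨List.eq_nil_of_length_eq_zero h2, Finset.card_eq_zero.1 h3⟩

/-- If all edges are present, all answers are positive. -/
lemma queries_eq_positives (s : DFSState V) (i j : ℕ) :
    (dfs G).queries G.edgeFinset s i j = (dfs G).positives G.edgeFinset s i j := by
  unfold Exploration.queries Exploration.positives
  congr 1
  refine Finset.filter_congr fun t _ => ?_
  rcases h : (dfs G).ask ((dfs G).run G.edgeFinset s t) with _ | e
  · simp [Exploration.ans_none _ h]
  · simp only [Exploration.ans_some _ h, Option.isSome_some, decide_eq_true_eq, true_iff]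
    exact (dfs G).mem_of_ask h

end DepthFirstSearch

end Percolation

namespace Percolation

/-! ### Flat periods in the height of the stack -/

section HeightProfile

/-- A discrete intermediate value theorem. -/
lemma exists_eq_of_step {n : ℕ → ℕ} (n0 : n 0 = 0) (hn : ∀ i, n (i + 1) ≤ n i + 1) {i v : ℕ}
    (hv : v ≤ n i) : ∃ j ≤ i, n j = v := by
  induction i with
  | zero => exact ⟨0, le_rfl, by omega⟩
  | succ i ih =>
    by_cases h : v ≤ n i
    · obtain ⟨j, h1, h2⟩ := ih h
      exact ⟨j, by omega, h2⟩
    · exact ⟨i + 1, le_rfl, by have := hn i; omega⟩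

/-- The last time before `i` when the height was `v`. -/
lemma exists_last_visit {h : ℕ → ℕ} (hh : ∀ i, h (i + 1) ≤ h i + 1) {i s v : ℕ} (hs : s ≤ i)
    (hsv : h s ≤ v) (hiv : v < h i) :
    ∃ l, s ≤ l ∧ l < i ∧ h l = v ∧ ∀ t, l < t → t ≤ i → v < h t := by
  obtain ⟨l, ⟨hl1, hl2⟩, hmax⟩ : ∃ l, (l ≤ i ∧ h l ≤ v) ∧ ∀ t, l < t → t ≤ i → v < h t := by
    refine ⟨Nat.findGreatest (fun l => h l ≤ v) i, ⟨Nat.findGreatest_le i,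
      Nat.findGreatest_spec (P := fun l => h l ≤ v) hs hsv⟩, fun t h1 h2 => ?_⟩
    exact not_le.1 (Nat.findGreatest_is_greatest (P := fun l => h l ≤ v) h1 h2)
  have hli : l ≠ i := by rintro rfl; omega
  have hlt : l < i := by omega
  refine ⟨l, ?_, hlt, ?_, hmax⟩
  · by_contra hc
    have := hmax s (by omega) hs
    omega
  · have h1 := hmax (l + 1) (by omega) (by omega)
    have h2 := hh l
    omega

/-- In a height profile that starts and ends at height `0` there is a first time `i` after which
the height has not grown much while `K` new vertices were discovered. Shortly before this, there is
a short period of time `l' … l` in which the height grew by `g`. -/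
lemma exists_flat_period {h n : ℕ → ℕ} (h0 : h 0 = 0) (n0 : n 0 = 0)
    (hh : ∀ i, h (i + 1) ≤ h i + 1 ∧ h i ≤ h (i + 1) + 1)
    (hn : ∀ i, n i ≤ n (i + 1) ∧ n (i + 1) ≤ n i + 1) {N K J Δ g L : ℕ} (hN : h N = 0)
    (hKN : K ≤ n N) (hK : 1 ≤ K) (hJ : 1 ≤ J) (hJK : K = J * Δ) (hL : L = J * g)
    (hL1 : 1 ≤ L) :
    ∃ i ≤ N, (∀ t < i, K ≤ n t → L < h t) ∧
      ((h i ≤ 3 * L ∧ K ≤ n i ∧ n i ≤ 3 * K) ∨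
        ∃ l' l, l' ≤ l ∧ l < i ∧ n l + K ≤ n i ∧ n i ≤ n l + 2 * K + 1 ∧ n l ≤ n l' + Δ + 1 ∧
          1 ≤ h l' ∧ h l = h l' + g ∧ (∀ t, l < t → t ≤ i → h l < h t) ∧
          (∀ t, l' ≤ t → t ≤ i → h l' ≤ h t) ∧ h i ≤ h l + 2 * L + 1) := by
  classical
  have nmono : Monotone n := monotone_nat_of_le_succ fun i => (hn i).1
  -- `P i`: while the last `K` vertices were discovered, the height was never more than `L` below
  -- its final value. It holds at `N`, where the height is `0`, so there is a first such time.
  let P : ℕ → Prop := fun i => ∃ j ≤ i, n j + K = n i ∧ ∀ t, j ≤ t → t ≤ i → h i ≤ h t + L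
  have hPN : ∃ i, P i := by
    obtain ⟨j, hj, hjv⟩ := exists_eq_of_step n0 (fun i => (hn i).2) (Nat.sub_le (n N) K)
    exact ⟨N, j, hj, by omega, fun t _ _ => by omega⟩
  have hiN : Nat.find hPN ≤ N := by
    obtain ⟨j, hj, hjv⟩ := exists_eq_of_step n0 (fun i => (hn i).2) (Nat.sub_le (n N) K)
    exact Nat.find_min' hPN ⟨j, hj, by omega, fun t _ _ => by omega⟩
  -- Before the first flat time one can jump back over at most `K` discoveries to a height lower by
  -- more than `L`. Such jumps are iterated below.
  have hmin : ∀ t < Nat.find hPN, K ≤ n t → ∃ s ≤ t, n t ≤ n s + K ∧ h s + L < h t := by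
    intro t ht hKt
    have hnot : ¬ P t := Nat.find_min hPN ht
    obtain ⟨j, hj, hjv⟩ := exists_eq_of_step n0 (fun i => (hn i).2) (Nat.sub_le (n t) K)
    by_contra hc
    push Not at hc
    refine hnot ⟨j, hj, by omega, fun s h1 h2 => hc s h2 ?_⟩
    have := nmono h1
    omega
  obtain ⟨j₁, hj₁, hnj, hflat⟩ : P (Nat.find hPN) := Nat.find_spec hPN
  revert hiN hmin hj₁ hnj hflat
  generalize Nat.find hPN = i
  intro hiN hmin hj₁ hnj hflat
  refine ⟨i, hiN, fun t ht hKt => ?_, ?_⟩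
  · obtain ⟨s, -, -, h3⟩ := hmin t ht hKt
    omega
  have hi : i ≠ 0 := by
    rintro rfl
    omega
  obtain ⟨i', rfl⟩ := Nat.exists_eq_succ_of_ne_zero hi
  have hhi := hh i'
  have hni := hn i'
  simp only [Nat.succ_eq_add_one] at *
  by_cases hcase : h (i' + 1) ≤ 3 * L
  · left
    refine ⟨hcase, by omega, ?_⟩
    -- With more than `3 * K` discoveries three jumps back from `i'` are possible, so the height
    -- there is at least `3 * L + 3`. But it is at most `3 * L + 1`.
    by_contra hc
    obtain ⟨t₁, a1, a2, a3⟩ := hmin i' (by omega) (by omega)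
    obtain ⟨t₂, b1, b2, b3⟩ := hmin t₁ (by omega) (by omega)
    obtain ⟨t₃, c1, c2, c3⟩ := hmin t₂ (by omega) (by omega)
    omega
  · right
    obtain ⟨s, hsi, hs1, hs2⟩ : ∃ s ≤ i' + 1, h s + 2 * L + 1 ≤ h (i' + 1) ∧
        n (i' + 1) ≤ n s + 2 * K + 1 := by
      by_cases hA : K ≤ n i'
      · obtain ⟨t₁, a1, a2, a3⟩ := hmin i' (by omega) hA
        by_cases hB : K ≤ n t₁
        · obtain ⟨t₂, b1, b2, b3⟩ := hmin t₁ (by omega) hB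
          exact ⟨t₂, by omega, by omega, by omega⟩
        · exact ⟨0, by omega, by omega, by omega⟩
      · exact ⟨0, by omega, by omega, by omega⟩
    -- Last visits to `J + 1` levels with spacing `g`, the highest lying `L + 1` below the final
    -- height. Being below the flat range, even that level was left before the last `K` discoveries
    -- began.
    have hlev : ∀ a, ∃ l, a ≤ J → s ≤ l ∧ l < i' + 1 ∧ h l = h (i' + 1) - L - 1 - a * g ∧
        ∀ t, l < t → t ≤ i' + 1 → h l < h t := by
      intro a
      by_cases ha : a ≤ J
      · have : a * g ≤ L := hL ▸ Nat.mul_le_mul_right g ha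
        obtain ⟨l, h1, h2, h3, h4⟩ := exists_last_visit (v := h (i' + 1) - L - 1 - a * g)
          (fun i => (hh i).1) hsi (by omega) (by omega)
        exact ⟨l, fun _ => ⟨h1, h2, h3, fun t ht ht' => h3 ▸ h4 t ht ht'⟩⟩
      · exact ⟨0, fun h => absurd h ha⟩
    choose f hf using hlev
    have hf0 : n (f 0) + K ≤ n (i' + 1) := by
      obtain ⟨h1, h2, h3, h4⟩ := hf 0 (by omega)
      have : f 0 < j₁ := by
        by_contra hc
        have := hflat (f 0) (by omega) (by omega)
        omega
      have := nmono this.le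
      omega
    -- Pigeonhole: from `s` to `f 0` there are at most `K + 1` discoveries, whereas `J` gaps of at
    -- least `Δ + 2` would need `K + 2 * J`.
    obtain ⟨a, ha, hgap⟩ : ∃ a < J, n (f a) ≤ n (f (a + 1)) + Δ + 1 := by
      by_contra hc
      push Not at hc
      have hind : ∀ a ≤ J, n (f a) + a * (Δ + 2) ≤ n (f 0) := by
        intro a
        induction a with
        | zero => simp
        | succ a ih =>
          intro ha
          have h1 := ih (by omega)
          have h2 := hc a (by omega)
          rw [add_mul, one_mul]
          omega
      have h1 := hind J le_rfl
      have h2 := nmono (hf J le_rfl).1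
      rw [mul_add, ← hJK] at h1
      omega
    obtain ⟨p1, p2, p3, p4⟩ := hf a ha.le
    obtain ⟨q1, q2, q3, q4⟩ := hf (a + 1) ha
    have hag : (a + 1) * g ≤ L := hL ▸ Nat.mul_le_mul_right g ha
    have hag' : (a + 1) * g = a * g + g := by ring
    have hle : f (a + 1) ≤ f a := by
      by_contra hc
      have := p4 (f (a + 1)) (by omega) (by omega)
      omega
    have hf0a : f a ≤ f 0 := by
      obtain ⟨o1, o2, o3, o4⟩ := hf 0 (by omega)
      by_contra hc
      have := o4 (f a) (by omega) (by omega)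
      omega
    have hna := nmono hf0a
    have hsa := nmono p1
    refine ⟨f (a + 1), f a, hle, p2, by omega, by omega, hgap, by omega, by omega, p4,
      fun t ht ht' => ?_, by omega⟩
    rcases ht.eq_or_lt with rfl | ht
    · exact le_rfl
    · exact (q4 t ht ht').le

end HeightProfile

end Percolation

namespace Percolation

/-! ### Flat periods force many edges that close long cycles -/

section LongCycle

variable {V : Type*} [DecidableEq V] (G : SimpleGraph V)

/-- The number of pairs of adjacent vertices in `P × W`. -/
noncomputable def edgeCount (P W : Finset V) : ℕ :=
  open Classical in ((P ×ˢ W).filter fun x => G.Adj x.1 x.2).card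

omit [DecidableEq V] in
lemma edgeCount_mono_right (P : Finset V) {W W' : Finset V} (h : W ⊆ W') :
    edgeCount G P W ≤ edgeCount G P W' := by
  classical
  exact Finset.card_le_card (Finset.filter_subset_filter _ (Finset.product_subset_product_right h))

lemma edgeCount_union_right_le (P W W' : Finset V) :
    edgeCount G P (W ∪ W') ≤ edgeCount G P W + edgeCount G P W' := by
  classical
  unfold edgeCount
  rw [Finset.product_union, Finset.filter_union]
  exact Finset.card_union_le _ _

omit [DecidableEq V] in
/-- Pairs of adjacent vertices in disjoint sets are counted by the corresponding edges. -/
lemma edgeCount_le_card {P W : Finset V} {S : Finset (Sym2 V)} (hPW : Disjoint P W)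
    (h : ∀ x ∈ P, ∀ y ∈ W, G.Adj x y → s(x, y) ∈ S) : edgeCount G P W ≤ S.card := by
  classical
  refine Finset.card_le_card_of_injOn (fun x => s(x.1, x.2)) ?_ ?_
  · intro x hx
    simp only [Finset.coe_filter, Finset.mem_product, Set.mem_ofPred_eq] at hx
    exact h _ hx.1.1 _ hx.1.2 hx.2
  · intro x hx y hy hxy
    simp only [Finset.coe_filter, Finset.mem_product, Set.mem_ofPred_eq] at hx hy
    rcases Sym2.eq_iff.1 hxy with ⟨h1, h2⟩ | ⟨h1, h2⟩
    · exact Prod.ext h1 h2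
    · exact absurd hy.1.2 (h1 ▸ Finset.disjoint_left.1 hPW hx.1.1)

variable [Fintype G.edgeSet]

/-- The edges of `G` whose ends are joined by a path of length at least `g` in the graph with edge
set `F`. -/
noncomputable def longEdges (F : Finset (Sym2 V)) (g : ℕ) : Finset (Sym2 V) :=
  open Classical in G.edgeFinset.filter fun e => ∃ x y, e = s(x, y) ∧
    ∃ w : (SimpleGraph.fromEdgeSet (F : Set (Sym2 V))).Walk x y, w.IsPath ∧ g ≤ w.length

variable {G}

/-- A vertex finished between `l` and `i` has had all its edges to unseen vertices asked by time
`i`, and none of them by time `l`, when both ends were unseen. -/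
lemma edgeCount_unseen_le (F : Finset (Sym2 V)) {U P : Finset V} {l i : ℕ} (hli : l ≤ i)
    (hP : ∀ x ∈ P, x ∈ (dfsState G F U l).unseen ∧ x ∉ (dfsState G F U i).unseen ∧
      x ∉ (dfsState G F U i).stack) :
    edgeCount G P (dfsState G F U i).unseen ≤ (dfs G).queries F ⟨[], U, ∅⟩ l i := by
  rw [← card_asked_sdiff F U hli]
  refine edgeCount_le_card G (Finset.disjoint_left.2 fun x hx => (hP x hx).2.1)
    fun x hx y hy hxy => ?_
  obtain ⟨h1, h2, h3⟩ := hP x hx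
  exact Finset.mem_sdiff.2 ⟨mem_asked F U i (unseen_subset F U l h1) h2 h3 hy hxy,
    notMem_asked F U l h1 (unseen_anti F U hli hy)⟩

/-- If the depth first search has no window with many questions and few positive answers, and
`G` expands, then there are many edges of `G` that close a long cycle. -/
theorem lt_card_longEdges (F : Finset (Sym2 V)) (U : Finset V) {K J Δ g L : ℕ}
    {D p β η M : ℝ} (hJ : 1 ≤ J) (hK : K = J * Δ) (hL : L = J * g) (hL1 : 1 ≤ L)
    (hLΔ : 2 * L + 2 ≤ 3 * Δ) (hLK : 6 * L + 2 ≤ K) (hKU : K ≤ U.card)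
    (hp : 0 < p) (hβ : 0 ≤ β)
    (hE : ∀ P Y : Finset V, P ⊆ Y → Y ⊆ U → (Y \ P).card ≤ 5 * Δ → P.card ≤ 4 * K →
      (K ≤ 2 * P.card ∨ (Y = P ∧ Δ ≤ P.card)) → D * P.card ≤ edgeCount G P (U \ Y))
    (hbad : ∀ i j, i ≤ 2 * U.card + G.edgeFinset.card → j ≤ 2 * U.card + G.edgeFinset.card →
      ¬ (dfs G).BadWindow p β η F ⟨[], U, ∅⟩ i j)
    (hnum : ∀ q : ℝ, K ≤ 2 * q → (1 + β) * (q + 3 * L + 1) + η + p * M < p * (D * q))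
    (hnum' : ∀ q : ℝ, Δ ≤ q → (1 + β) * q + η < p * (D * q)) :
    M < (longEdges G F g).card := by
  by_contra hM
  push Not at hM
  have hΔ : 1 ≤ Δ := by omega
  set st := dfsState G F U with hst
  set N := 2 * U.card + G.edgeFinset.card with hN
  have hcard : ∀ i, (st i).unseen.card ≤ U.card := fun i =>
    Finset.card_le_card (unseen_subset F U i)
  have hseen : ∀ i, (U \ (st i).unseen).card = U.card - (st i).unseen.card := fun i =>
    Finset.card_sdiff_of_subset (unseen_subset F U i)
  have hpos : ∀ {l i : ℕ}, l ≤ i → ((dfs G).positives F ⟨[], U, ∅⟩ l i : ℝ) ≤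
      ((st l).unseen.card - (st i).unseen.card : ℕ) := fun hli => by
    have := unseen_card_add_positives (G := G) F U hli
    rw [← hst] at this
    exact_mod_cast (by omega)
  have hq : ∀ {l i : ℕ}, l ≤ i → i ≤ N → p * (dfs G).queries F ⟨[], U, ∅⟩ l i <
      (1 + β) * ((st l).unseen.card - (st i).unseen.card : ℕ) + η := fun {l i} hli hiN => by
    have h1 := hbad l i (hli.trans hiN) hiN
    unfold Exploration.BadWindow at h1
    have h2 := mul_le_mul_of_nonneg_left (hpos hli) (by linarith : 0 ≤ 1 + β)
    linarith
  -- the stack is not empty after more than `Δ` steps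
  have hempty : ∀ t ≤ N, (st t).stack.length = 0 → U.card - (st t).unseen.card ≤ 4 * K →
      U.card - (st t).unseen.card < Δ := by
    intro t htN ht htK
    by_contra hc
    push Not at hc
    have hnil := List.eq_nil_of_length_eq_zero ht
    have h1 := hE (U \ (st t).unseen) (U \ (st t).unseen) (Finset.Subset.refl _)
      Finset.sdiff_subset (by simp) (by rw [hseen]; exact htK) (Or.inr ⟨rfl, by rw [hseen]; exact hc⟩)
    rw [Finset.sdiff_sdiff_eq_self (unseen_subset F U t), hseen] at h1
    have h2 := edgeCount_unseen_le (G := G) F (U := U) (P := U \ (st t).unseen) (Nat.zero_le t)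
      fun x hx => by
        rw [Finset.mem_sdiff] at hx
        exact ⟨hx.1, hx.2, by rw [← hst, hnil]; simp⟩
    have h3 := hq (Nat.zero_le t) htN
    have h4 := hnum' (U.card - (st t).unseen.card : ℕ) (by exact_mod_cast hc)
    have h5 : (edgeCount G (U \ (st t).unseen) (st t).unseen : ℝ) ≤
      (dfs G).queries F ⟨[], U, ∅⟩ 0 t := by exact_mod_cast h2
    have h6 : (st 0).unseen.card = U.card := by rw [hst, dfsState_zero]
    rw [h6] at h3
    have h7 := mul_le_mul_of_nonneg_left (h1.trans h5) hp.le
    linarith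
  obtain ⟨i, hiN, hhigh, hcases⟩ := exists_flat_period (h := fun i => (st i).stack.length)
    (n := fun i => U.card - (st i).unseen.card) (N := N) (K := K) (J := J) (Δ := Δ) (g := g)
    (L := L) (by simp [hst]) (by simp [hst]) (fun i => length_stack_succ F U i)
    (fun i => by
      have h1 := card_unseen_succ (G := G) F U i
      have h2 := Finset.card_le_card (unseen_anti (G := G) F U (Nat.le_succ i))
      have h3 := hcard i
      simp only [Nat.succ_eq_add_one, ← hst] at *
      omega)
    (by simp [hst, (dfsState_end (G := G) F U hN.ge).1])
    (by simpa [hst, (dfsState_end (G := G) F U hN.ge).2] using hKU) (by omega) hJ hK hL hL1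
  have hi := hcard i
  rcases hcases with ⟨hh, hn1, hn2⟩ | ⟨l', l, hl'l, hli, hn1, hn2, hn3, hpos', hlev, hup, hup', hdown⟩
  · -- everything seen so far is almost closed
    set P := (U \ (st i).unseen) \ (st i).stack.toFinset with hP
    have hst' : (st i).stack.toFinset ⊆ U \ (st i).unseen := fun v hv => by
      have := (stack_unseen (G := G) F U i).2 v (List.mem_toFinset.1 hv)
      exact Finset.mem_sdiff.2 this
    have hYP : (U \ (st i).unseen) \ P = (st i).stack.toFinset := Finset.sdiff_sdiff_eq_self hst'
    have hsc : (st i).stack.toFinset.card = (st i).stack.length :=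
      List.toFinset_card_of_nodup (stack_unseen F U i).1
    have hPc : P.card = U.card - (st i).unseen.card - (st i).stack.length := by
      rw [hP, Finset.card_sdiff_of_subset hst', hseen, hsc]
    have h1 := hE P (U \ (st i).unseen) Finset.sdiff_subset Finset.sdiff_subset
      (by rw [hYP, hsc]; omega) (by omega) (Or.inl (by omega))
    rw [Finset.sdiff_sdiff_eq_self (unseen_subset F U i)] at h1
    have h2 := edgeCount_unseen_le (G := G) F (U := U) (P := P) (Nat.zero_le i)
      fun x hx => by
        rw [hP, Finset.mem_sdiff, Finset.mem_sdiff, List.mem_toFinset] at hx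
        exact ⟨hx.1.1, hx.1.2, hx.2⟩
    have h3 := hq (Nat.zero_le i) hiN
    have h6 : (st 0).unseen.card = U.card := by rw [hst, dfsState_zero]
    rw [h6] at h3
    have h5 : (edgeCount G P (st i).unseen : ℝ) ≤
      (dfs G).queries F ⟨[], U, ∅⟩ 0 i := by exact_mod_cast h2
    have h4 := hnum P.card (by exact_mod_cast (by omega : K ≤ 2 * P.card))
    have h7 := mul_le_mul_of_nonneg_left (h1.trans h5) hp.le
    have h8 : ((U.card - (st i).unseen.card : ℕ) : ℝ) ≤ P.card + 3 * L + 1 := by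
      exact_mod_cast (by omega)
    have h9 := mul_le_mul_of_nonneg_left h8 (by linarith : 0 ≤ 1 + β)
    have h10 : 0 ≤ M := le_trans (Nat.cast_nonneg _) hM
    have h11 := mul_nonneg hp.le h10
    linarith
  · obtain ⟨r, -, hrl', hr0, hrpos⟩ := exists_last_visit
      (h := fun i => (st i).stack.length) (fun i => (length_stack_succ F U i).1)
      (Nat.zero_le l') (v := 0) (by simp [hst]) (by omega)
    have hrn : U.card - (st r).unseen.card < Δ := by
      refine hempty r (by omega) hr0 ?_
      by_contra hc
      have := hhigh r (by omega) (by omega)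
      omega
    have hanti1 := unseen_anti (G := G) F U hli.le
    have hanti2 := unseen_anti (G := G) F U hl'l
    have hanti3 := unseen_anti (G := G) F U hrl'.le
    rw [← hst] at hanti1 hanti2 hanti3
    obtain ⟨A, hA, hAl⟩ := exists_stack_eq_append (G := G) F U hli.le (fun t h1 h2 => by
      rcases h1.eq_or_lt with rfl | h1
      · exact le_rfl
      · exact (hup t h1 h2).le)
    rw [← hst] at hA hAl
    -- `P` is what was discovered after `l` and finished by `i`. Discounting `Y`, which adds to it
    -- the discoveries since `l'` and all older trees, an edge leaving `P` ends either in an unseen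
    -- vertex or in a vertex of the current tree seen before the climb from `l'` to `l`.
    set P := ((st l).unseen \ (st i).unseen) \ A.toFinset with hP
    set Y := ((st l').unseen \ (st i).unseen) ∪ (U \ (st r).unseen) with hY
    have hAs : A.toFinset.card ≤ 2 * L + 1 := by
      refine (List.toFinset_card_le A).trans ?_
      have := congrArg List.length hA
      rw [List.length_append] at this
      omega
    have hsub : P ⊆ (st l').unseen \ (st i).unseen := by
      refine Finset.sdiff_subset.trans (Finset.sdiff_subset_sdiff hanti2 (Finset.Subset.refl _))
    have hS : ((st l).unseen \ (st i).unseen).card = (st l).unseen.card - (st i).unseen.card :=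
      Finset.card_sdiff_of_subset hanti1
    have hS' : ((st l').unseen \ (st i).unseen).card = (st l').unseen.card - (st i).unseen.card :=
      Finset.card_sdiff_of_subset (hanti1.trans hanti2)
    have hPle : P.card ≤ (st l).unseen.card - (st i).unseen.card := by
      rw [← hS]; exact Finset.card_le_card Finset.sdiff_subset
    have hPge : (st l).unseen.card - (st i).unseen.card ≤ P.card + (2 * L + 1) := by
      rw [← hS]
      have := Finset.le_card_sdiff A.toFinset ((st l).unseen \ (st i).unseen)
      rw [← hP] at this
      omega
    -- At most `Δ + 1` vertices come from the climb, `2 * L + 1` from the stack and fewer than `Δ`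
    -- from older trees; `hLΔ` absorbs the stack.
    have hYP : (Y \ P).card ≤ 5 * Δ := by
      have h1 : Y \ P ⊆ (((st l').unseen \ (st i).unseen) \ P) ∪ (U \ (st r).unseen) := by
        rw [hY, Finset.union_sdiff_distrib]
        exact Finset.union_subset_union (Finset.Subset.refl _) Finset.sdiff_subset
      have h2 := (Finset.card_le_card h1).trans (Finset.card_union_le _ _)
      rw [Finset.card_sdiff_of_subset hsub, hS', hseen] at h2
      have := hcard l
      have := hcard l'
      have := Finset.card_le_card hanti1
      have := Finset.card_le_card hanti2
      omega
    have hYU : Y ⊆ U :=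
      Finset.union_subset (Finset.sdiff_subset.trans (unseen_subset F U l')) Finset.sdiff_subset
    have := hcard l
    have := Finset.card_le_card hanti1
    have h1 := hE P Y (hsub.trans Finset.subset_union_left) hYU hYP (by omega) (Or.inl (by omega))
    have hW : U \ Y ⊆ (st i).unseen ∪ ((st r).unseen \ (st l').unseen) := by
      intro v hv
      simp only [hY, Finset.mem_sdiff, Finset.mem_union, not_or, not_and, not_not] at hv ⊢
      have := hv.2.2 hv.1
      have := hv.2.1
      tauto
    have h2 : edgeCount G P (U \ Y) ≤ edgeCount G P (st i).unseen +
        edgeCount G P ((st r).unseen \ (st l').unseen) := by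
      exact (edgeCount_mono_right G P hW).trans (edgeCount_union_right_le G P _ _)
    have hPmem : ∀ x ∈ P, x ∈ (st l).unseen ∧ x ∉ (st i).unseen ∧ x ∉ (st i).stack := by
      intro x hx
      rw [hP, Finset.mem_sdiff, Finset.mem_sdiff, List.mem_toFinset] at hx
      refine ⟨hx.1.1, hx.1.2, ?_⟩
      rw [hA, List.mem_append, not_or]
      exact ⟨hx.2, fun h => ((stack_unseen F U l).2 x h).2 hx.1.1⟩
    have h3 := edgeCount_unseen_le (G := G) F (U := U) hli.le hPmem
    -- When `x` is discovered, it is on top of a stack that exceeds its height at time `l'` by more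
    -- than `g`, and `y` is connected to the top vertex of time `l'`.
    have h4 : edgeCount G P ((st r).unseen \ (st l').unseen) ≤ (longEdges G F g).card := by
      refine edgeCount_le_card G (Finset.disjoint_left.2 fun x hx hx' => ?_)
        fun x hx y hy hxy => ?_
      · exact (Finset.mem_sdiff.1 hx').2 (hanti2 (hPmem x hx).1)
      · obtain ⟨hx1, hx2, -⟩ := hPmem x hx
        obtain ⟨τ, rest, hτ1, hτ2, hτ3⟩ := exists_discovery (G := G) F U hli.le hx1 hx2
        rw [Finset.mem_sdiff] at hy
        have hτh := hup τ hτ1 hτ2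
        obtain ⟨w, hw, hwl⟩ := exists_long_path (G := G) F U hrl'.le
          (fun t ht ht' h0 => by
            have := hrpos t ht ht'
            simp only [hst, h0] at this
            simp at this)
          (fun h0 => by
            simp only [hst, h0] at hpos'
            simp at hpos')
          hy.1 hy.2 (by omega : l' ≤ τ) (fun t ht ht' => hup' t ht (by omega)) hτ3
          (by rw [← hst]; omega)
        rw [← hst] at hwl
        classical
        refine Finset.mem_filter.2 ⟨by simpa using hxy, x, y, rfl, w, hw, by omega⟩
    have h5 := hq hli.le hiN
    have h6 := hnum P.card (by exact_mod_cast (by omega : K ≤ 2 * P.card))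
    have h7 : (edgeCount G P (U \ Y) : ℝ) ≤ (dfs G).queries F ⟨[], U, ∅⟩ l i + M := by
      have : (edgeCount G P (U \ Y) : ℝ) ≤
          (dfs G).queries F ⟨[], U, ∅⟩ l i + (longEdges G F g).card := by
        exact_mod_cast h2.trans (add_le_add h3 h4)
      linarith
    have h8 : (((st l).unseen.card - (st i).unseen.card : ℕ) : ℝ) ≤ P.card + 3 * L + 1 := by
      exact_mod_cast (by omega)
    have h9 := mul_le_mul_of_nonneg_left h8 (by linarith : 0 ≤ 1 + β)
    have h10 := mul_le_mul_of_nonneg_left (h1.trans h7) hp.le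
    linarith

end LongCycle

end Percolation

namespace Percolation

/-! ### From expansion of `k`-sets to expansion of all smaller sets -/

section Reservoir

variable {V : Type*} [Fintype V] {G : SimpleGraph V}

lemma mem_extNbhd {S : Finset V} {v : V} :
    v ∈ extNbhd G S ↔ v ∉ S ∧ ∃ u ∈ S, G.Adj u v := by
  classical
  simp [extNbhd]

lemma card_extNbhd_union_le [DecidableEq V] (X Z : Finset V) :
    (extNbhd G (X ∪ Z)).card ≤ (extNbhd G X).card + (extNbhd G Z \ X).card := by
  refine (Finset.card_le_card fun v hv => ?_).trans (Finset.card_union_le _ _)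
  simp only [Finset.mem_union, Finset.mem_sdiff, mem_extNbhd, not_or] at hv ⊢
  obtain ⟨⟨h1, h2⟩, u, hu, huv⟩ := hv
  rcases hu with hu | hu
  · exact Or.inl ⟨h1, u, hu, huv⟩
  · exact Or.inr ⟨⟨h2, u, hu, huv⟩, h1⟩

/-- Concavity: the square root lies below its tangent at `r`. -/
lemma div_two_mul_sqrt_le {r z : ℝ} (hr : 0 < r) (hzr : z ≤ r) :
    z / (2 * √r) ≤ √r - √(r - z) := by
  have h1 : 0 < √r := Real.sqrt_pos.2 hr
  rw [div_le_iff₀ (by positivity)]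
  have h2 := Real.sq_sqrt hr.le
  have h3 := Real.sq_sqrt (sub_nonneg.2 hzr)
  nlinarith [sq_nonneg (√r - √(r - z))]

/-- In a graph where the sets of one fixed size expand, one can delete few vertices so that
in the rest all sets up to a certain size expand even better. -/
theorem exists_reservoir [DecidableEq V] {k d : ℕ} (hk : 1 ≤ k) (hd : 1 ≤ d)
    (hG : IsExpanderAt G k d) {ε : ℝ} (hε : 0 < ε) (hε1 : ε ≤ 1) :
    ∃ (X : Finset V) (r : ℕ) (e : ℝ), X.card < k ∧ 1 ≤ r ∧ r ≤ k ∧ ε / 8 ≤ e ∧ e ≤ 1 ∧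
      ε ^ 2 * k / 128 ≤ e ^ 2 * r ∧
      ∀ Z : Finset V, Disjoint X Z → Z.card ≤ r →
        (1 - ε / 2 + e) * d * Z.card ≤ (extNbhd G Z \ X).card := by
  classical
  have hk0 : (0 : ℝ) < k := by exact_mod_cast hk
  have hd0 : (0 : ℝ) < d := by exact_mod_cast hd
  -- A convex gauge with slope (1 - ε/2)d + (ε/8)d√(k/(k - x)). Adding `Z` to a minimiser `X` of
  -- |N(S)| - φ(|S|) gains at least the increment of φ. As the slope surplus is proportional to
  -- r^(-1/2) with r = k - |X|, the value e²r does not depend on |X|.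
  set φ : ℝ → ℝ := fun x => (1 - ε / 2) * d * x + ε / 4 * d * (k - √k * √(k - x)) with hφ
  obtain ⟨X, hX, hmin⟩ := Finset.exists_min_image
    ((Finset.univ : Finset (Finset V)).filter fun S => S.card ≤ k)
    (fun S => ((extNbhd G S).card : ℝ) - φ S.card) ⟨∅, by simp⟩
  simp only [Finset.mem_filter, Finset.mem_univ, true_and] at hX hmin
  have hkk : √(k : ℝ) * √k = k := Real.mul_self_sqrt hk0.le
  have hX0 : ((extNbhd G X).card : ℝ) ≤ φ X.card := by
    have h1 := hmin ∅ (by simp)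
    have h2 : extNbhd G ∅ = ∅ := by
      ext v; simp [mem_extNbhd]
    have h3 : φ 0 = 0 := by simp [hφ, hkk]
    rw [h2, Finset.card_empty, Nat.cast_zero, h3] at h1
    linarith
  have hφk : φ X.card ≤ (1 - ε / 4) * d * k := by
    have h1 : (0 : ℝ) ≤ √k * √(k - X.card) := by positivity
    have h2 : (X.card : ℝ) ≤ k := by exact_mod_cast hX
    have h3 : (1 - ε / 2) * d * X.card ≤ (1 - ε / 2) * d * k :=
      mul_le_mul_of_nonneg_left h2 (mul_nonneg (by linarith) hd0.le)
    have h4 : 0 ≤ ε / 4 * d * (√k * √(k - X.card)) := by positivity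
    simp only [hφ]
    linarith
  have hdk : (0 : ℝ) < ε * d * k := by positivity
  have hXk : X.card < k := by
    refine lt_of_le_of_ne hX fun h => ?_
    have h1 := hG X h
    rw [h] at h1
    have h2 : (d * k : ℝ) ≤ (extNbhd G X).card := by exact_mod_cast h1
    linarith
  set r := k - X.card with hr
  have hr1 : 1 ≤ r := by omega
  have hr0 : (0 : ℝ) < r := by exact_mod_cast hr1
  have hrk : (r : ℝ) = k - X.card := by rw [hr]; exact Nat.cast_sub hX
  have hrk' : (r : ℝ) ≤ k := by rw [hrk]; linarith [(Nat.cast_nonneg X.card : (0 : ℝ) ≤ X.card)]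
  set e := ε / 8 * (√k / √r) with he
  have hsr : 0 < √(r : ℝ) := Real.sqrt_pos.2 hr0
  have hexp : ∀ Z : Finset V, Disjoint X Z → Z.card ≤ r →
      (1 - ε / 2 + e) * d * Z.card ≤ (extNbhd G Z \ X).card := by
    intro Z hXZ hZ
    have hu : (X ∪ Z).card = X.card + Z.card := Finset.card_union_of_disjoint hXZ
    have h1 := hmin (X ∪ Z) (by omega)
    have h2 : ((extNbhd G (X ∪ Z)).card : ℝ) ≤ (extNbhd G X).card + (extNbhd G Z \ X).card := by
      exact_mod_cast card_extNbhd_union_le X Z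
    have h3 := div_two_mul_sqrt_le (r := r) (z := Z.card) hr0 (by exact_mod_cast hZ)
    have h4 : φ (X ∪ Z).card - φ X.card =
        (1 - ε / 2) * d * Z.card + ε / 4 * d * √k * (√r - √(r - Z.card)) := by
      simp only [hφ, hu, hrk]
      push_cast
      rw [sub_add_eq_sub_sub (k : ℝ)]
      ring
    have h5 := mul_le_mul_of_nonneg_left h3 (by positivity : 0 ≤ ε / 4 * d * √k)
    have h6 : ε / 4 * d * √k * (Z.card / (2 * √r)) = e * d * Z.card := by
      rw [he]; ring
    linarith
  have he2 : e ^ 2 * r = ε ^ 2 * k / 64 := by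
    rw [he, mul_pow, div_pow (√(k : ℝ)), Real.sq_sqrt hk0.le, Real.sq_sqrt hr0.le]
    field_simp
    norm_num
  -- If `e > 1`, surplus is traded for range, with `e = 1` and a larger `r'`. A larger `Z` contains
  -- a set completing `X` to `k` vertices, which brings at least εdk/4 neighbours not already in
  -- N(X), far more than needed since |Z| ≤ εk/64.
  by_cases he1 : e ≤ 1
  · refine ⟨X, r, e, hXk, hr1, by exact_mod_cast hrk', ?_, he1, ?_, hexp⟩
    · rw [he]
      refine le_mul_of_one_le_right (by positivity) ?_
      rw [one_le_div hsr]
      exact Real.sqrt_le_sqrt hrk'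
    · have : 0 ≤ ε ^ 2 * k := by positivity
      rw [he2]; linarith
  push Not at he1
  have hr2 : (r : ℝ) < ε ^ 2 * k / 64 := by
    rw [← he2]
    exact lt_mul_of_one_lt_left hr0 (by nlinarith)
  set r' := ⌊ε ^ 2 * k / 64⌋₊ with hr'
  have hrr' : r ≤ r' := Nat.le_floor hr2.le
  have hr'1 : (1 : ℝ) ≤ r' := by exact_mod_cast hr1.trans hrr'
  have hr'2 : (r' : ℝ) ≤ ε ^ 2 * k / 64 := Nat.floor_le (by positivity)
  have hr'3 : ε ^ 2 * k / 64 < r' + 1 := Nat.lt_floor_add_one _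
  have hεε : ε ^ 2 * k ≤ ε * k := by
    refine mul_le_mul_of_nonneg_right ?_ hk0.le
    nlinarith
  have hεk : ε * k ≤ k := mul_le_of_le_one_left hk0.le hε1
  refine ⟨X, r', 1, hXk, hr1.trans hrr', ?_, by linarith, le_rfl, by linarith, fun Z hXZ hZ => ?_⟩
  · have : (r' : ℝ) ≤ k := by linarith
    exact_mod_cast this
  rcases le_total Z.card r with hZr | hZr
  · refine le_trans ?_ (hexp Z hXZ hZr)
    gcongr
  obtain ⟨Z₀, hZ₀, hZ₀r⟩ := Finset.exists_subset_card_eq hZr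
  have hu : (X ∪ Z₀).card = k := by
    rw [Finset.card_union_of_disjoint (Finset.disjoint_of_subset_right hZ₀ hXZ)]
    omega
  have h1 : (d * k : ℝ) ≤ (extNbhd G (X ∪ Z₀)).card := by
    have := hG _ hu
    rw [hu] at this
    exact_mod_cast this
  have h2 : ((extNbhd G (X ∪ Z₀)).card : ℝ) ≤ (extNbhd G X).card + (extNbhd G Z₀ \ X).card := by
    exact_mod_cast card_extNbhd_union_le X Z₀
  have h3 : ((extNbhd G Z₀ \ X).card : ℝ) ≤ (extNbhd G Z \ X).card + Z.card := by
    have : extNbhd G Z₀ \ X ⊆ (extNbhd G Z \ X) ∪ Z := fun v hv => by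
      simp only [Finset.mem_union, Finset.mem_sdiff, mem_extNbhd] at hv ⊢
      obtain ⟨⟨-, u, hu, huv⟩, hvX⟩ := hv
      by_cases hvZ : v ∈ Z
      · exact Or.inr hvZ
      · exact Or.inl ⟨⟨hvZ, u, hZ₀ hu, huv⟩, hvX⟩
    exact_mod_cast (Finset.card_le_card this).trans (Finset.card_union_le _ _)
  have h4 : (Z.card : ℝ) ≤ ε * k / 64 := by
    have : (Z.card : ℝ) ≤ r' := by exact_mod_cast hZ
    linarith
  have hd1 : (1 : ℝ) ≤ d := by exact_mod_cast hd
  have h5 : (d : ℝ) * Z.card ≤ d * (ε * k / 64) := mul_le_mul_of_nonneg_left h4 hd0.le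
  have h6 : (Z.card : ℝ) ≤ d * Z.card := le_mul_of_one_le_left (Nat.cast_nonneg _) hd1
  have h7 : 0 ≤ ε / 2 * d * Z.card := by positivity
  linarith

end Reservoir

end Percolation

namespace Percolation

/-! ### Edge expansion outside the reservoir and choice of parameters -/

section Parameters

variable {V : Type*} [Fintype V] [DecidableEq V] {G : SimpleGraph V}

lemma card_extNbhd_sdiff_le_edgeCount (P W : Finset V) :
    (extNbhd G P ∩ W).card ≤ edgeCount G P W := by
  classical
  have h : extNbhd G P ∩ W ⊆
      ((P ×ˢ W).filter fun x => G.Adj x.1 x.2).image Prod.snd := fun v hv => by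
    rw [Finset.mem_inter, mem_extNbhd] at hv
    obtain ⟨⟨-, u, hu, huv⟩, hvW⟩ := hv
    exact Finset.mem_image.2 ⟨(u, v), by simp [hu, hvW, huv], rfl⟩
  exact (Finset.card_le_card h).trans Finset.card_image_le

omit [Fintype V] in
lemma edgeCount_add_le {P Q W : Finset V} (hQP : Q ⊆ P) :
    edgeCount G Q W + edgeCount G (P \ Q) W ≤ edgeCount G P W := by
  classical
  unfold edgeCount
  rw [← Finset.card_union_of_disjoint]
  · refine Finset.card_le_card fun x hx => ?_
    simp only [Finset.mem_union, Finset.mem_filter, Finset.mem_product, Finset.mem_sdiff] at hx ⊢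
    rcases hx with ⟨⟨h1, h2⟩, h3⟩ | ⟨⟨h1, h2⟩, h3⟩
    · exact ⟨⟨hQP h1, h2⟩, h3⟩
    · exact ⟨⟨h1.1, h2⟩, h3⟩
  · rw [Finset.disjoint_left]
    intro x hx hx'
    simp only [Finset.mem_filter, Finset.mem_product, Finset.mem_sdiff] at hx hx'
    exact hx'.1.1.2 hx.1.1

variable {X : Finset V} {r : ℕ} {a e d : ℝ}

/-- Only neighbours in `Y \ P` are lost, and half of the surplus `e` pays for them. -/
lemma le_edgeCount_of_card_le
    (hexp : ∀ Z : Finset V, Disjoint X Z → Z.card ≤ r →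
      (a + e) * d * Z.card ≤ (extNbhd G Z \ X).card)
    {P Y : Finset V} (hPY : P ⊆ Y) (hXY : Disjoint X Y) (hPr : P.card ≤ r)
    (hY : ((Y \ P).card : ℝ) ≤ e / 2 * d * P.card) :
    (a + e / 2) * d * P.card ≤ edgeCount G P (Xᶜ \ Y) := by
  have h1 := hexp P (Finset.disjoint_of_subset_right hPY hXY) hPr
  have h2 : extNbhd G P \ X ⊆ (extNbhd G P ∩ (Xᶜ \ Y)) ∪ (Y \ P) := fun v hv => by
    simp only [Finset.mem_union, Finset.mem_sdiff, Finset.mem_inter, Finset.mem_compl,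
      mem_extNbhd] at hv ⊢
    by_cases hvY : v ∈ Y
    · exact Or.inr ⟨hvY, hv.1.1⟩
    · exact Or.inl ⟨hv.1, hv.2, hvY⟩
  have h3 := (Finset.card_le_card h2).trans (Finset.card_union_le _ _)
  have h4 := card_extNbhd_sdiff_le_edgeCount (G := G) P (Xᶜ \ Y)
  have h5 : ((extNbhd G P \ X).card : ℝ) ≤ edgeCount G P (Xᶜ \ Y) + (Y \ P).card := by
    exact_mod_cast h3.trans (Nat.add_le_add_right h4 _)
  linarith

/-- Sets larger than `r` are cut into pieces of between r/2 and r vertices. Counting edges instead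
of neighbours makes the bounds for the pieces add up. -/
lemma le_edgeCount_of_le_card
    (hexp : ∀ Z : Finset V, Disjoint X Z → Z.card ≤ r →
      (a + e) * d * Z.card ≤ (extNbhd G Z \ X).card) (hr : 1 ≤ r) (he : 0 ≤ e) (hd : 0 ≤ d)
    {P Y : Finset V} (hPY : P ⊆ Y) (hXY : Disjoint X Y) (hPr : r ≤ 2 * P.card)
    (hY : (Y.card : ℝ) ≤ e / 4 * d * r) :
    (a + e / 2) * d * P.card ≤ edgeCount G P (Xᶜ \ Y) := by
  induction hm : P.card using Nat.strong_induction_on generalizing P with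
  | _ m ih =>
    have hsmall : ∀ Q : Finset V, Q ⊆ Y → Q.card ≤ r → r ≤ 2 * Q.card →
        (a + e / 2) * d * Q.card ≤ edgeCount G Q (Xᶜ \ Y) := fun Q hQ h1 h2 => by
      refine le_edgeCount_of_card_le hexp hQ hXY h1 ?_
      have h3 : ((Y \ Q).card : ℝ) ≤ Y.card := by
        exact_mod_cast Finset.card_le_card Finset.sdiff_subset
      have h4 : (r : ℝ) ≤ 2 * Q.card := by exact_mod_cast h2
      have h5 := mul_le_mul_of_nonneg_left h4 (by positivity : 0 ≤ e / 4 * d)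
      linarith
    rcases le_or_gt P.card r with h | h
    · rw [← hm]
      exact hsmall P hPY h hPr
    · obtain ⟨Q, hQ, hQc⟩ := Finset.exists_subset_card_eq (by omega : (r + 1) / 2 ≤ P.card)
      have hc : (P \ Q).card = P.card - Q.card := Finset.card_sdiff_of_subset hQ
      have h1 := ih (P \ Q).card (by omega) (Finset.sdiff_subset.trans hPY) (by omega) rfl
      have h2 := hsmall Q (hQ.trans hPY) (by omega) (by omega)
      have h3 : ((edgeCount G Q (Xᶜ \ Y) + edgeCount G (P \ Q) (Xᶜ \ Y) : ℕ) : ℝ) ≤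
        edgeCount G P (Xᶜ \ Y) := by exact_mod_cast edgeCount_add_le hQ
      have h4 : (m : ℝ) = (P \ Q).card + Q.card := by
        exact_mod_cast (by omega : m = (P \ Q).card + Q.card)
      push_cast at h3
      rw [h4]
      linarith

lemma mul_add_card_le {k d : ℕ} (hG : IsExpanderAt G k d) (hk : k ≤ Fintype.card V) :
    d * k + k ≤ Fintype.card V := by
  obtain ⟨S, -, hS⟩ := Finset.exists_subset_card_eq
    (by simpa using hk : k ≤ (Finset.univ : Finset V).card)
  have h1 := hG S hS
  have h2 : Disjoint (extNbhd G S) S := Finset.disjoint_left.2 fun v hv => (mem_extNbhd.1 hv).1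
  have h3 := Finset.card_le_univ (extNbhd G S ∪ S)
  rw [Finset.card_union_of_disjoint h2] at h3
  rw [hS] at h1 h3
  omega

/-- The choice of the parameters of the depth first search. -/
lemma exists_parameters {r d : ℕ} {e : ℝ} (hd : 2 ≤ d) (he0 : 0 < e) (he1 : e ≤ 1)
    {κ : ℝ} (hκ : 10 ≤ κ) (hbig : 122 * κ ≤ e ^ 2 * d * r / 640) :
    ∃ J Δ g : ℕ, 1 ≤ J ∧ 1 ≤ g ∧ κ ≤ g ∧ 100 * κ ≤ e * Δ ∧ 400 ≤ e * Δ ∧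
      Δ ≤ e * d * r / 640 ∧ r ≤ 16 * (J * Δ) ∧ (4 * (J * Δ) ≤ r ∨ J = 1) ∧
      2 * (J * g) + 2 ≤ 3 * Δ ∧ 100 * g ≤ e * Δ := by
  -- Small enough for a loss of `5 * Δ` vertices to be covered by the surplus (e/2)d|P| when |P| ≥
  -- r/32.
  set Δ := ⌊e * d * r / 640⌋₊ with hΔ
  have h1 : (Δ : ℝ) ≤ e * d * r / 640 := Nat.floor_le (by positivity)
  have h2 : e * d * r / 640 < Δ + 1 := Nat.lt_floor_add_one _
  have h3 : 121 * κ ≤ e * Δ := by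
    have := mul_le_mul_of_nonneg_left h2.le he0.le
    have h : e * (e * d * r / 640) = e ^ 2 * d * r / 640 := by ring
    rw [h] at this
    linarith
  set g := ⌊e * Δ / 100⌋₊ with hg
  have hg1 : (g : ℝ) ≤ e * Δ / 100 := Nat.floor_le (by positivity)
  have hg2 : e * Δ / 100 < g + 1 := Nat.lt_floor_add_one _
  have hκg : κ ≤ g := by linarith
  have hg3 : 1 ≤ g := by
    have : (1 : ℝ) ≤ g := by linarith
    exact_mod_cast this
  have heΔ : e * Δ ≤ Δ := mul_le_of_le_one_left (Nat.cast_nonneg _) he1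
  have hΔ1 : (1210 : ℝ) ≤ Δ := by linarith
  have hΔ1' : 1210 ≤ Δ := by exact_mod_cast hΔ1
  have hgΔ : 100 * g ≤ Δ := by
    have : (100 : ℝ) * g ≤ Δ := by linarith
    exact_mod_cast this
  -- `J` is chosen to place `J * Δ` between r/16 and r/8, unless `Δ` alone already exceeds r/16.
  by_cases hr : 16 * Δ ≤ r
  · obtain ⟨q, hq1, hq2⟩ : ∃ q, 16 * (q * Δ) ≤ r ∧ r < 16 * (q * Δ) + 16 * Δ := by
      have h4 := Nat.div_add_mod r (16 * Δ)
      have h5 := Nat.mod_lt r (by omega : 0 < 16 * Δ)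
      have h6 : 16 * Δ * (r / (16 * Δ)) = 16 * (r / (16 * Δ) * Δ) := by ring
      exact ⟨r / (16 * Δ), by omega, by omega⟩
    have hJΔ : (q + 1) * Δ = q * Δ + Δ := by ring
    refine ⟨q + 1, Δ, g, by omega, hg3, hκg, by linarith, by linarith, h1, by omega,
      Or.inl (by omega), ?_, by linarith⟩
    · have hK : 8 * ((q + 1) * Δ) ≤ r := by omega
      set J := q + 1
      have h4 : (J : ℝ) * g ≤ J * (e * Δ / 100) := by gcongr
      have h5 : e * (8 * ((J : ℝ) * Δ)) ≤ e * r :=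
        mul_le_mul_of_nonneg_left (by exact_mod_cast hK) he0.le
      have h6 : e * 2 * r ≤ e * d * r := by
        gcongr; exact_mod_cast hd
      have : (2 : ℝ) * (J * g) + 2 ≤ 3 * Δ := by linarith
      exact_mod_cast this
  · exact ⟨1, Δ, g, le_rfl, hg3, hκg, by linarith, by linarith, h1, by omega, Or.inr rfl,
      by omega, by linarith⟩

/-- `U` is the complement of the reservoir. It does not depend on `F` or `p`, so the statement
serves both the first round of exposure and the full graph with `p = 1`. -/
theorem exists_lt_card_longEdges [Fintype G.edgeSet] {k d : ℕ} (hk : 1 ≤ k) (hd : 2 ≤ d)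
    (hkV : k ≤ Fintype.card V) (hG : IsExpanderAt G k d) {ε : ℝ} (hε : 0 < ε) (hε1 : ε ≤ 1 / 2)
    {κ : ℝ} (hκ : κ = ε ^ 2 * d * k / 10 ^ 7) (hκ10 : 10 ≤ κ) :
    ∃ (U : Finset V) (g : ℕ), κ ≤ g ∧ ∀ (F : Finset (Sym2 V)) (p : ℝ), 0 < p →
      1 + 3 * ε / 4 ≤ p * d →
      (∀ i j, i ≤ 2 * U.card + G.edgeFinset.card → j ≤ 2 * U.card + G.edgeFinset.card →
        ¬ (dfs G).BadWindow p (ε / 64) κ F ⟨[], U, ∅⟩ i j) →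
      κ / p < (longEdges G F g).card := by
  obtain ⟨X, r, e, hXk, hr1, hrk, he8, he1, her, hexp⟩ :=
    exists_reservoir hk (by omega : 1 ≤ d) hG hε (by linarith)
  have he0 : 0 < e := by linarith
  have hd0 : (0 : ℝ) < d := by exact_mod_cast (by omega : 0 < d)
  -- The constant 10⁷ in `κ` comes from here: 122 · 128 · 640 is just below it.
  obtain ⟨J, Δ, g, hJ, hg1, hκg, hΔκ, hΔ400, hΔr, hrK, hKr, hLΔ, hgΔ⟩ :=
    exists_parameters (r := r) (d := d) hd he0 he1 hκ10 (by
      have := mul_le_mul_of_nonneg_left her hd0.le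
      rw [hκ]
      have h0 : 0 ≤ ε ^ 2 * d * k := by positivity
      linarith)
  set K := J * Δ with hK
  have hΔK : Δ ≤ K := Nat.le_mul_of_pos_left Δ hJ
  have hΔKR : (Δ : ℝ) ≤ K := by exact_mod_cast hΔK
  have hgK : 100 * ((J * g : ℕ) : ℝ) ≤ e * K := by
    have := mul_le_mul_of_nonneg_left hgΔ (Nat.cast_nonneg J : (0 : ℝ) ≤ J)
    rw [hK]
    push_cast
    linarith
  have heK : e * K ≤ K := mul_le_of_le_one_left (Nat.cast_nonneg _) he1
  have heΔK : e * Δ ≤ e * K := mul_le_mul_of_nonneg_left hΔKR he0.le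
  have hL1 : 1 ≤ J * g := Nat.mul_pos hJ hg1
  have hrKR : (r : ℝ) ≤ 16 * K := by exact_mod_cast hrK
  have hΔdk : Δ ≤ d * k := by
    have h1 : e * d * r ≤ 1 * d * k := by gcongr
    have h2 : (0 : ℝ) ≤ d * k := by positivity
    have : (Δ : ℝ) ≤ d * k := by linarith
    exact_mod_cast this
  refine ⟨Xᶜ, g, hκg, fun F p hp hpd hbad => ?_⟩
  -- The search stays supercritical: the gain 3ε/4 in `p` outweighs the loss ε/2 in expansion.
  have hpD : ∀ q : ℝ, 0 ≤ q → (1 + e / 2) * q ≤ p * ((1 - ε / 2 + e / 2) * d * q) := fun q hq => by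
    have h1 : (1 + 3 * ε / 4) * (1 - ε / 2 + e / 2) ≤ p * d * (1 - ε / 2 + e / 2) :=
      mul_le_mul_of_nonneg_right hpd (by linarith)
    have h2 : 1 + e / 2 ≤ (1 + 3 * ε / 4) * (1 - ε / 2 + e / 2) := by nlinarith
    have h3 := mul_le_mul_of_nonneg_right (h2.trans h1) hq
    linarith
  refine lt_card_longEdges (D := (1 - ε / 2 + e / 2) * d) (β := ε / 64) (η := κ)
    F Xᶜ hJ hK rfl hL1 hLΔ ?_ ?_ hp (by positivity) ?_ hbad ?_ ?_
  · have : 6 * ((J * g : ℕ) : ℝ) + 2 ≤ K := by linarith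
    exact_mod_cast this
  · have h1 := mul_add_card_le hG hkV
    rw [Finset.card_compl]
    have h2 : K ≤ d * k := by
      rcases hKr with h | h
      · have : k ≤ d * k := Nat.le_mul_of_pos_left k (by omega)
        omega
      · rw [hK, h]; omega
    omega
  · intro P Y hPY hYU hYP hP4 hcase
    have hXY : Disjoint X Y := by
      rw [Finset.disjoint_left]
      exact fun v hv hv' => Finset.mem_compl.1 (hYU hv') hv
    have hYPR : ((Y \ P).card : ℝ) ≤ 5 * Δ := by exact_mod_cast hYP
    rcases le_or_gt P.card r with hPr | hPr
    · refine le_edgeCount_of_card_le hexp hPY hXY hPr ?_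
      rcases hcase with h | ⟨rfl, -⟩
      · have h1 : (K : ℝ) ≤ 2 * P.card := by exact_mod_cast h
        have h2 : (r : ℝ) ≤ 32 * P.card := by linarith
        have h3 := mul_le_mul_of_nonneg_left h2 (by positivity : 0 ≤ e * d)
        linarith
      · rw [Finset.sdiff_self, Finset.card_empty, Nat.cast_zero]
        positivity
    · have hJ1 : J = 1 := by
        rcases hKr with h | h
        · omega
        · exact h
      refine le_edgeCount_of_le_card hexp hr1 he0.le hd0.le hPY hXY (by omega) ?_
      have h1 : Y.card ≤ 9 * Δ := by
        have := Finset.card_sdiff_of_subset hPY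
        rw [hK, hJ1] at hP4
        omega
      have h2 : (Y.card : ℝ) ≤ 9 * Δ := by exact_mod_cast h1
      have h3 : 0 ≤ e * d * r := by positivity
      linarith
  · intro q hq
    have hq0 : 0 ≤ q := by linarith [(Nat.cast_nonneg K : (0 : ℝ) ≤ K)]
    refine lt_of_lt_of_le ?_ (hpD q hq0)
    rw [mul_div_cancel₀ _ hp.ne']
    have h1 : ε / 64 * q ≤ e / 8 * q := mul_le_mul_of_nonneg_right (by linarith) hq0
    have h2 : ε / 64 * (3 * ((J * g : ℕ) : ℝ) + 1) ≤ 1 / 8 * (3 * ((J * g : ℕ) : ℝ) + 1) :=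
      mul_le_mul_of_nonneg_right (by linarith) (by positivity)
    have h3 := mul_le_mul_of_nonneg_left hq he0.le
    linarith
  · intro q hq
    have hq0 : 0 ≤ q := by linarith [(Nat.cast_nonneg Δ : (0 : ℝ) ≤ Δ)]
    refine lt_of_lt_of_le ?_ (hpD q hq0)
    have h1 : ε / 64 * q ≤ e / 8 * q := mul_le_mul_of_nonneg_right (by linarith) hq0
    have h3 := mul_le_mul_of_nonneg_left hq he0.le
    linarith

end Parameters

end Percolation

namespace Percolation

/-! ### Long cycles in the expander itself -/

section Cycles

variable {V : Type*} [Fintype V] {G : SimpleGraph V}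

/-- In a graph without cycles, every nonempty set contains a vertex with at most one neighbour in
the set. -/
lemma exists_card_adj_le_one [DecidableRel G.Adj] (hG : G.IsAcyclic) {W : Finset V}
    (hW : W.Nonempty) : ∃ v ∈ W, (W.filter (G.Adj v)).card ≤ 1 := by
  classical
  by_contra! hdeg
  obtain ⟨v, hv⟩ := hW
  -- A second neighbour in `W` always extends the path, since in a forest it cannot lie on it; so
  -- paths would be arbitrarily long.
  have hpath : ∀ m : ℕ, ∃ (u : V) (w : G.Walk u v), w.IsPath ∧ u ∈ W ∧ w.length = m := by
    intro m
    induction m with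
    | zero => exact ⟨v, .nil, .nil, hv, rfl⟩
    | succ m ih =>
      obtain ⟨u, w, hw, hu, hm⟩ := ih
      obtain ⟨x, hx, hxs⟩ := Finset.exists_mem_ne (hdeg u hu) w.snd
      rw [Finset.mem_filter] at hx
      exact ⟨x, .cons hx.2.symm w,
        hw.cons fun h => hxs (hG.eq_snd_of_adj_start hw hx.2 h), hx.1, by simp [hm]⟩
  obtain ⟨u, w, hw, -, hm⟩ := hpath (Fintype.card V)
  exact absurd hw.length_lt hm.not_lt

/-- Greedy choice: adding a vertex with at most one neighbour among the remaining vertices enlarges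
the neighbourhood by at most one. -/
lemma exists_card_extNbhd_le (hG : G.IsAcyclic) {m : ℕ} (hm : m ≤ Fintype.card V) :
    ∃ S : Finset V, S.card = m ∧ (extNbhd G S).card ≤ m := by
  classical
  induction m with
  | zero =>
    refine ⟨∅, rfl, le_of_eq (Finset.card_eq_zero.2 ?_)⟩
    ext v
    simp [mem_extNbhd]
  | succ m ih =>
    obtain ⟨S, hS, hN⟩ := ih (by omega)
    have hne : Sᶜ.Nonempty := by
      rw [← Finset.card_pos, Finset.card_compl]
      omega
    obtain ⟨v, hv, hdeg⟩ := exists_card_adj_le_one hG hne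
    rw [Finset.mem_compl] at hv
    refine ⟨insert v S, by rw [Finset.card_insert_of_notMem hv, hS], ?_⟩
    have h : extNbhd G (insert v S) ⊆ extNbhd G S ∪ Sᶜ.filter (G.Adj v) := fun x hx => by
      simp only [mem_extNbhd, Finset.mem_insert, not_or, Finset.mem_union, Finset.mem_filter,
        Finset.mem_compl] at hx ⊢
      obtain ⟨⟨-, hxS⟩, u, rfl | hu, hux⟩ := hx
      · exact Or.inr ⟨hxS, hux⟩
      · exact Or.inl ⟨hxS, u, hu, hux⟩
    have := (Finset.card_le_card h).trans (Finset.card_union_le _ _)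
    omega

/-- An expander contains a cycle. -/
lemma IsExpanderAt.not_isAcyclic {k d : ℕ} (hG : IsExpanderAt G k d) (hk : 1 ≤ k) (hd : 2 ≤ d)
    (hkV : k ≤ Fintype.card V) : ¬ G.IsAcyclic := fun h => by
  obtain ⟨S, hS, hN⟩ := exists_card_extNbhd_le h hkV
  have h1 := hG S hS
  rw [hS] at h1
  nlinarith

omit [Fintype V] in
lemma HasCycleOfLengthAtLeast.mono {H : SimpleGraph V} {a b : ℝ} (hab : a ≤ b)
    (h : HasCycleOfLengthAtLeast H b) : HasCycleOfLengthAtLeast H a := by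
  obtain ⟨v, w, hw, hb⟩ := h
  exact ⟨v, w, hw, hab.trans hb⟩

variable [Fintype G.edgeSet]

omit [Fintype V] in
lemma longEdges_subset (F : Finset (Sym2 V)) (g : ℕ) : longEdges G F g ⊆ G.edgeFinset :=
  fun e he => by
    simp only [longEdges, Finset.mem_filter] at he
    exact he.1

omit [Fintype V] in
lemma hasCycle_of_mem_longEdges {F F' : Finset (Sym2 V)} {g : ℕ} (hg : 2 ≤ g) {e : Sym2 V}
    (he : e ∈ longEdges G F g) (heF : e ∈ F') (hF : F ⊆ F') :
    HasCycleOfLengthAtLeast (SimpleGraph.fromEdgeSet (F' : Set (Sym2 V))) g := by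
  simp only [longEdges, Finset.mem_filter, SimpleGraph.mem_edgeFinset] at he
  obtain ⟨heG, x, y, rfl, w, hw, hwg⟩ := he
  have hxy : x ≠ y := (SimpleGraph.mem_edgeSet G |>.1 heG).ne
  have hle : SimpleGraph.fromEdgeSet (F : Set (Sym2 V)) ≤
      SimpleGraph.fromEdgeSet (F' : Set (Sym2 V)) :=
    SimpleGraph.fromEdgeSet_mono (by exact_mod_cast hF)
  have hadj : (SimpleGraph.fromEdgeSet (F' : Set (Sym2 V))).Adj y x := by
    rw [SimpleGraph.fromEdgeSet_adj]
    exact ⟨by rw [Sym2.eq_swap]; exact_mod_cast heF, hxy.symm⟩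
  have hpath : (w.mapLe hle).IsPath := SimpleGraph.Walk.IsPath.mapLe hle hw
  have hlen : (w.mapLe hle).length = w.length := by simp
  refine ⟨y, .cons hadj (w.mapLe hle), (SimpleGraph.Walk.cons_isCycle_iff _ _).2 ⟨hpath, ?_⟩, ?_⟩
  · intro h
    have := hpath.length_eq_one_of_mem_edges (Sym2.eq_swap ▸ h)
    omega
  · rw [SimpleGraph.Walk.length_cons, hlen]
    exact_mod_cast by omega

/-- The expander itself contains a long cycle. -/
theorem IsExpanderAt.hasCycle [DecidableEq V] {k d : ℕ} (hk : 1 ≤ k) (hd : 2 ≤ d)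
    (hkV : k ≤ Fintype.card V) (hG : IsExpanderAt G k d) {ε : ℝ} (hε : 0 < ε) (hε1 : ε ≤ 1 / 2) :
    HasCycleOfLengthAtLeast G (ε ^ 2 * d * k / 10 ^ 7 / 5) := by
  set κ := ε ^ 2 * d * k / 10 ^ 7 with hκ
  have hκ0 : 0 ≤ κ := by positivity
  -- Below `10` any cycle will do, because its length is at least 3 > κ/5.
  rcases lt_or_ge κ 10 with h | h
  · have h1 := hG.not_isAcyclic hk hd hkV
    unfold SimpleGraph.IsAcyclic at h1
    push Not at h1
    obtain ⟨v, w, hw⟩ := h1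
    refine ⟨v, w, hw, ?_⟩
    have : (3 : ℝ) ≤ w.length := by exact_mod_cast hw.three_le_length
    linarith
  · obtain ⟨U, g, hg, hlong⟩ := exists_lt_card_longEdges hk hd hkV hG hε hε1 hκ h
    -- With all edges present every answer is positive, so no window is bad.
    have h1 := hlong G.edgeFinset 1 one_pos (by
      have : (2 : ℝ) ≤ d := by exact_mod_cast hd
      linarith) fun i j _ _ hb => by
        unfold Exploration.BadWindow at hb
        rw [queries_eq_positives] at hb
        have h2 : 0 ≤ ε / 64 * (dfs G).positives G.edgeFinset ⟨[], U, ∅⟩ i j := by positivity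
        linarith
    have h2 : 0 < (longEdges G G.edgeFinset g).card := by
      have : (0 : ℝ) < (longEdges G G.edgeFinset g).card := lt_of_le_of_lt (by simpa using hκ0) h1
      exact_mod_cast this
    obtain ⟨e, he⟩ := Finset.card_pos.1 h2
    have heG := longEdges_subset _ _ he
    have hg2 : 2 ≤ g := by
      have : (2 : ℝ) ≤ g := by linarith
      exact_mod_cast this
    have h3 := hasCycle_of_mem_longEdges hg2 he heG (Finset.Subset.refl _)
    rw [SimpleGraph.coe_edgeFinset, SimpleGraph.fromEdgeSet_edgeSet] at h3
    exact h3.mono (by linarith)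

end Cycles

/-! ### Two-round exposure -/

section Sprinkling

variable {V : Type*} [Fintype V] {G : SimpleGraph V}

lemma pow_card_le_bexp {α : Type*} {E : Finset α} {p : ℝ} (hp0 : 0 ≤ p) (hp1 : p ≤ 1)
    {f : Finset α → ℝ} (hf : ∀ F, 0 ≤ f F) : p ^ E.card * f E ≤ bexp E p f := by
  classical
  have h := Finset.single_le_sum
    (f := fun F => p ^ F.card * (1 - p) ^ (E.card - F.card) * f F) (s := E.powerset)
    (fun F _ => mul_nonneg (mul_nonneg (pow_nonneg hp0 _) (pow_nonneg (by linarith) _)) (hf F))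
    (Finset.mem_powerset_self E)
  simpa [bexp] using h

/-- The two-round exposure: with high probability the first round creates many edges of `G` that close a
long cycle, and the second round hits one of them. -/
theorem one_sub_le_randomSubgraph {k d : ℕ} (hk : 1 ≤ k) (hd : 2 ≤ d)
    (hkV : k ≤ Fintype.card V) (hG : IsExpanderAt G k d) {ε : ℝ} (hε : 0 < ε) (hε1 : ε ≤ 1 / 2)
    {κ : ℝ} (hκ : κ = ε ^ 2 * d * k / 10 ^ 7) (hκ10 : 10 ≤ κ) (p : I)
    (hp : (p : ℝ) = (1 + ε) / d) :
    1 - (((Fintype.card V : ℝ) + 1) ^ 4 + 1) * Real.exp (-(ε / 64 * κ)) ≤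
      (randomSubgraph G p).real {H | HasCycleOfLengthAtLeast H κ} := by
  classical
  have hd0 : (0 : ℝ) < d := by exact_mod_cast (by omega : 0 < d)
  have hp1 : (p : ℝ) ≤ 1 := p.2.2
  set p₁ : ℝ := (1 + 3 * ε / 4) / d with hp₁
  have hp₁0 : 0 < p₁ := by positivity
  have hpp : (p : ℝ) - p₁ = ε / 4 / d := by rw [hp, hp₁]; ring
  have hpp0 : 0 < (p : ℝ) - p₁ := by rw [hpp]; positivity
  have hp₁1 : 0 < 1 - p₁ := by linarith
  set p₂ : ℝ := (p - p₁) / (1 - p₁) with hp₂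
  have hp₂0 : 0 ≤ p₂ := div_nonneg hpp0.le hp₁1.le
  have hp₂1 : p₂ ≤ 1 := by rw [hp₂, div_le_one hp₁1]; linarith
  have hp₁₂ : 1 - (p : ℝ) = (1 - p₁) * (1 - p₂) := by rw [hp₂]; field_simp; ring
  -- This makes the failure exponent of the second round at least that of a bad window, so both
  -- errors are bounded by the same exponential.
  have hratio : ε / 64 * p₁ ≤ p₂ := by
    have h1 : (p : ℝ) - p₁ ≤ p₂ := by
      rw [hp₂, le_div_iff₀ hp₁1]
      nlinarith
    refine le_trans ?_ h1
    rw [hpp, hp₁, mul_div_assoc', div_le_div_iff_of_pos_right hd0]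
    nlinarith
  obtain ⟨U, g, hg, hlong⟩ := exists_lt_card_longEdges hk hd hkV hG hε hε1 hκ hκ10
  have hg2 : 2 ≤ g := by
    have : (2 : ℝ) ≤ g := by linarith
    exact_mod_cast this
  set E := G.edgeFinset with hE
  set N := 2 * U.card + E.card with hN
  set A : Set (SimpleGraph V) := {H | HasCycleOfLengthAtLeast H κ} with hA
  set bad : Finset (Sym2 V) → Prop := fun F => ∃ i j, i ≤ N ∧ j ≤ N ∧
    (dfs G).BadWindow p₁ (ε / 64) κ F ⟨[], U, ∅⟩ i j with hbad
  have hcompl : (1 : ℝ) - bexp E (p : ℝ)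
      (fun F => if SimpleGraph.fromEdgeSet (F : Set (Sym2 V)) ∈ A then 0 else 1) =
      bexp E (p : ℝ) (fun F => if SimpleGraph.fromEdgeSet (F : Set (Sym2 V)) ∈ A then 1 else 0) := by
    rw [sub_eq_iff_eq_add, ← bexp_add]
    refine (bexp_const E (p : ℝ) 1).symm.trans (bexp_congr fun F _ => ?_)
    split_ifs <;> norm_num
  rw [randomSubgraph_real_eq, ← hE, ← hcompl]
  refine sub_le_sub_left ?_ 1
  rw [bexp_union E hp₁₂]
  have hinner : ∀ F₁ ⊆ E, bexp E p₂ (fun F₂ =>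
      if SimpleGraph.fromEdgeSet ((F₁ ∪ F₂ : Finset (Sym2 V)) : Set (Sym2 V)) ∈ A
        then (0 : ℝ) else 1) ≤ (if bad F₁ then 1 else 0) + Real.exp (-(ε / 64 * κ)) := by
    intro F₁ hF₁
    split_ifs with hb
    · refine (bexp_mono hp₂0 hp₂1 (g := fun _ => (1 : ℝ)) fun F _ => ?_).trans ?_
      · split_ifs <;> norm_num
      · rw [bexp_const]
        linarith [Real.exp_pos (-(ε / 64 * κ))]
    · have hM := hlong F₁ p₁ hp₁0 (by rw [hp₁, div_mul_cancel₀ _ hd0.ne'])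
        fun i j hi hj h => hb ⟨i, j, hi, hj, h⟩
      have hLE : longEdges G F₁ g ⊆ E := longEdges_subset _ _
      rw [zero_add]
      calc _ ≤ bexp E p₂ (fun F => if Disjoint F (longEdges G F₁ g) then 1 else 0) := by
            refine bexp_mono hp₂0 hp₂1 fun F _ => ?_
            by_cases hdis : Disjoint F (longEdges G F₁ g)
            · rw [if_pos hdis]
              split_ifs <;> norm_num
            · rw [if_neg hdis, if_pos]
              obtain ⟨e, heF, heL⟩ := Finset.not_disjoint_iff.1 hdis
              exact (hasCycle_of_mem_longEdges hg2 heL (Finset.mem_union_right _ heF)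
                Finset.subset_union_left).mono hg
        _ = (1 - p₂) ^ (longEdges G F₁ g).card := bexp_disjoint hLE p₂
        _ ≤ Real.exp (-p₂) ^ (longEdges G F₁ g).card :=
            pow_le_pow_left₀ (by linarith) (Real.one_sub_le_exp_neg p₂) _
        _ = Real.exp (-(p₂ * (longEdges G F₁ g).card)) := by
            rw [← Real.exp_nat_mul]; congr 1; ring
        _ ≤ Real.exp (-(ε / 64 * κ)) := by
            rw [Real.exp_le_exp, neg_le_neg_iff]
            rw [div_lt_iff₀ hp₁0] at hM
            have h1 := mul_le_mul_of_nonneg_right hratio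
              (Nat.cast_nonneg (longEdges G F₁ g).card : (0 : ℝ) ≤ _)
            have h2 := mul_le_mul_of_nonneg_left hM.le (by positivity : 0 ≤ ε / 64)
            linarith
  refine (bexp_mono hp₁0.le (by linarith) hinner).trans ?_
  rw [bexp_add, bexp_const, add_mul, one_mul]
  refine add_le_add ?_ le_rfl
  have hprob := (dfs G).bexp_exists_badWindow_le (β := ε / 64) (η := κ) hp₁0.le (by linarith)
    (by positivity) (by linarith) ⟨[], U, ∅⟩ N
  refine (le_of_eq (bexp_congr fun F _ => if_congr Iff.rfl rfl rfl)).trans (hprob.trans ?_)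
  refine mul_le_mul_of_nonneg_right ?_ (Real.exp_pos _).le
  have h1 : U.card ≤ Fintype.card V := Finset.card_le_univ U
  have h2 : E.card ≤ (Fintype.card V) ^ 2 :=
    SimpleGraph.card_edgeFinset_le_card_choose_two.trans (Nat.choose_le_pow _ _)
  have h3 : N + 1 ≤ (Fintype.card V + 1) ^ 2 := by nlinarith
  have h4 : ((N : ℝ) + 1) ≤ ((Fintype.card V : ℝ) + 1) ^ 2 := by exact_mod_cast h3
  calc ((N : ℝ) + 1) ^ 2 ≤ (((Fintype.card V : ℝ) + 1) ^ 2) ^ 2 := by gcongr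
    _ = _ := by ring

lemma eventually_poly_mul_exp_le {θ : ℝ} (hθ : 0 < θ) :
    ∀ᶠ n : ℕ in Filter.atTop,
      (((n : ℝ) + 1) ^ 4 + 1) * Real.exp (-(θ * n)) ≤ Real.exp (-(θ / 2 * n)) := by
  have h1 : Filter.Tendsto (fun x : ℝ => x ^ 4 * Real.exp (-(θ / 2) * x)) Filter.atTop (nhds 0) := by
    refine (tendsto_rpow_mul_exp_neg_mul_atTop_nhds_zero 4 (θ / 2) (by positivity)).congr fun x => ?_
    norm_cast
  have h2 := (h1.comp tendsto_natCast_atTop_atTop).eventually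
    -- 17 = 2⁴ + 1, from n + 1 ≤ 2n and 1 ≤ n⁴.
    (eventually_le_nhds (by norm_num : (0 : ℝ) < 1 / 17))
  filter_upwards [h2, Filter.eventually_ge_atTop 1] with n hn hn1
  have hn1' : (1 : ℝ) ≤ n := by exact_mod_cast hn1
  have h3 : (n : ℝ) + 1 ≤ 2 * n := by linarith
  have h4 : ((n : ℝ) + 1) ^ 4 ≤ (2 * n) ^ 4 := by gcongr
  have h5 : (1 : ℝ) ≤ n ^ 4 := one_le_pow₀ hn1'
  have h6 : ((n : ℝ) + 1) ^ 4 + 1 ≤ 17 * n ^ 4 := by nlinarith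
  simp only [Function.comp] at hn
  have h7 : Real.exp (-(θ * n)) = Real.exp (-(θ / 2) * n) * Real.exp (-(θ / 2 * n)) := by
    rw [← Real.exp_add]; congr 1; ring
  rw [h7, ← mul_assoc]
  refine mul_le_of_le_one_left (Real.exp_pos _).le ?_
  have h8 := mul_le_mul_of_nonneg_right h6 (Real.exp_pos (-(θ / 2) * n)).le
  linarith

end Sprinkling

end Percolation

/-! ### Conclusion: large and small vertex sets -/

theorem theorem1p3 :
    ∃ C : ℝ, 0 < C ∧
      ∀ c : ℝ, 0 < c → c < 1 →
        ∃ ε₀ : ℝ, 0 < ε₀ ∧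
          ∀ ε : ℝ, 0 < ε → ε ≤ ε₀ →
            ∃ γ : ℝ, 0 < γ ∧
              ∀ (V : Type*) [Fintype V] (G : SimpleGraph V) (d k : ℕ) (p : unitInterval),
                1 ≤ d →
                -- `k` is `c n / d`, rounded up or down to a positive integer
                1 ≤ k → |(k : ℝ) - c * (Fintype.card V : ℝ) / (d : ℝ)| < 1 →
                Percolation.IsExpanderAt G k d →
                (p : ℝ) = (1 + ε) / (d : ℝ) →
                1 - Real.exp (-(γ * (Fintype.card V : ℝ))) ≤
                  (Percolation.randomSubgraph G p).real
                    {H | Percolation.HasCycleOfLengthAtLeast H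
                      (C * ε ^ 2 * c ^ 2 * (Fintype.card V : ℝ))} := by
  open Percolation in
  refine ⟨1 / 10 ^ 8, by norm_num, fun c hc0 hc1 => ⟨1 / 2, by norm_num, fun ε hε hε1 => ?_⟩⟩
  set θ : ℝ := ε / 64 * (ε ^ 2 * c / (2 * 10 ^ 7)) with hθ
  have hθ0 : 0 < θ := by positivity
  obtain ⟨n₀, hn₀⟩ := Filter.eventually_atTop.1
    ((eventually_poly_mul_exp_le hθ0).and (Filter.eventually_ge_atTop
      ⌈10 / (ε ^ 2 * c / (2 * 10 ^ 7))⌉₊))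
  -- A lower bound, for n < n₀, on the probability that all edges survive: there are at most (n₀ +
  -- 1)² edges, and p ≥ 1/d ≥ 1/(n₀ + 1).
  set δ : ℝ := (1 / ((n₀ : ℝ) + 1)) ^ ((n₀ + 1) ^ 2) with hδ
  have hδ0 : 0 < δ := by positivity
  refine ⟨min (θ / 2) (δ / (n₀ + 1)), by positivity, ?_⟩
  intro V _ G d k p hd1 hk hkc hG hp
  classical
  have hd0 : (0 : ℝ) < d := by exact_mod_cast hd1
  have hp1 : (p : ℝ) ≤ 1 := p.2.2
  -- For d = 1 the density would be 1 + ε > 1.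
  have hd2 : 2 ≤ d := by
    by_contra h
    have : d = 1 := by omega
    rw [this] at hp
    norm_num at hp
    linarith
  have hd2' : (2 : ℝ) ≤ d := by exact_mod_cast hd2
  set n := Fintype.card V with hn
  rw [abs_lt, sub_lt_iff_lt_add', lt_sub_iff_add_lt] at hkc
  have hkV : k ≤ n := by
    rcases Nat.eq_zero_or_pos n with h0 | h0
    · rw [h0] at hkc
      norm_num at hkc
      have := hkc.2
      omega
    · have h1 : c * n / d ≤ n / 2 := by
        have : c * n ≤ 1 * n := by gcongr
        have h0' : (0 : ℝ) ≤ n := by positivity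
        calc c * n / d ≤ (1 * n) / 2 := by gcongr
          _ = n / 2 := by ring
      have h2 : (1 : ℝ) ≤ n := by exact_mod_cast h0
      have h3 : (k : ℝ) < n + 1 := by linarith [hkc.2]
      exact_mod_cast Nat.lt_succ_iff.1 (by exact_mod_cast h3)
  have hdkn := mul_add_card_le hG hkV
  -- As k ≥ 1, rounding costs at most a factor 2: cn/d < k + 1 ≤ 2k.
  have hcn : c * n / 2 ≤ d * k := by
    have h1 : c * n < d * (k + 1) := by
      have := hkc.1
      have h : c * n / d < k + 1 := by linarith
      rwa [div_lt_iff₀ hd0, mul_comm _ (d : ℝ)] at h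
    have h2 : (1 : ℝ) ≤ k := by exact_mod_cast hk
    nlinarith
  set κ := ε ^ 2 * d * k / 10 ^ 7 with hκ
  have hκn : ε ^ 2 * c / (2 * 10 ^ 7) * n ≤ κ := by
    have := mul_le_mul_of_nonneg_left hcn (sq_nonneg ε)
    rw [hκ]
    linarith
  -- The argument yields order ε²cn; only c² ≤ c is used to reach the stated length.
  have htarget : 1 / 10 ^ 8 * ε ^ 2 * c ^ 2 * n ≤ κ / 5 := by
    have h1 : c ^ 2 ≤ c := by nlinarith
    have h2 := mul_le_mul_of_nonneg_left h1 (by positivity : 0 ≤ ε ^ 2 * n)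
    linarith
  rcases le_or_gt n₀ n with hlarge | hsmall
  · obtain ⟨hpoly, hceil⟩ := hn₀ n hlarge
    have hκ10 : 10 ≤ κ := by
      refine le_trans ?_ hκn
      rw [← div_le_iff₀' (by positivity)]
      exact Nat.ceil_le.1 hceil
    have h1 := one_sub_le_randomSubgraph hk hd2 hkV hG hε hε1 hκ hκ10 p hp
    have h2 : {H : SimpleGraph V | HasCycleOfLengthAtLeast H κ} ⊆
        {H | HasCycleOfLengthAtLeast H (1 / 10 ^ 8 * ε ^ 2 * c ^ 2 * n)} :=
      fun H hH => hH.mono (by linarith)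
    have h3 : Real.exp (-(ε / 64 * κ)) ≤ Real.exp (-(θ * n)) := by
      rw [Real.exp_le_exp, neg_le_neg_iff, hθ, mul_assoc]
      exact mul_le_mul_of_nonneg_left hκn (by positivity)
    have h4 : Real.exp (-(θ / 2 * n)) ≤ Real.exp (-(min (θ / 2) (δ / (n₀ + 1)) * n)) := by
      rw [Real.exp_le_exp, neg_le_neg_iff]
      exact mul_le_mul_of_nonneg_right (min_le_left _ _) (Nat.cast_nonneg _)
    have h5 := mul_le_mul_of_nonneg_left h3 (by positivity : 0 ≤ ((n : ℝ) + 1) ^ 4 + 1)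
    refine le_trans (by linarith) (h1.trans ?_)
    rw [randomSubgraph_real_eq, randomSubgraph_real_eq]
    refine bexp_mono p.2.1 hp1 fun F _ => ?_
    by_cases hF : SimpleGraph.fromEdgeSet (F : Set (Sym2 V)) ∈
        {H : SimpleGraph V | HasCycleOfLengthAtLeast H κ}
    · rw [if_pos hF, if_pos (h2 hF)]
    · rw [if_neg hF]
      split_ifs <;> norm_num
  · have hcyc := (hG.hasCycle hk hd2 hkV hε hε1).mono htarget
    have h1 := pow_card_le_bexp (E := G.edgeFinset) p.2.1 hp1
      (f := fun F => if SimpleGraph.fromEdgeSet (F : Set (Sym2 V)) ∈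
        {H | HasCycleOfLengthAtLeast H (1 / 10 ^ 8 * ε ^ 2 * c ^ 2 * n)} then 1 else 0)
      (fun F => by split_ifs <;> norm_num)
    rw [← randomSubgraph_real_eq] at h1
    refine le_trans ?_ h1
    rw [if_pos (by
      rw [SimpleGraph.coe_edgeFinset, SimpleGraph.fromEdgeSet_edgeSet]
      exact hcyc), mul_one]
    have hn0 : (0 : ℝ) < (n₀ : ℝ) + 1 := by positivity
    have hnn : (n : ℝ) ≤ n₀ + 1 := by exact_mod_cast (by omega : n ≤ n₀ + 1)
    have hdn : (d : ℝ) ≤ n₀ + 1 := by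
      have : d ≤ d * k := Nat.le_mul_of_pos_right d hk
      exact_mod_cast (by omega : d ≤ n₀ + 1)
    have hpn : 1 / ((n₀ : ℝ) + 1) ≤ p := by
      rw [hp]
      calc 1 / ((n₀ : ℝ) + 1) ≤ 1 / d := by gcongr
        _ ≤ (1 + ε) / d := by gcongr; linarith
    have hEn : G.edgeFinset.card ≤ (n₀ + 1) ^ 2 :=
      (SimpleGraph.card_edgeFinset_le_card_choose_two.trans (Nat.choose_le_pow _ _)).trans
        (Nat.pow_le_pow_left (by omega) 2)
    have h2 : δ ≤ (p : ℝ) ^ G.edgeFinset.card :=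
      (pow_le_pow_of_le_one (by positivity) (hpn.trans hp1) hEn).trans
        (pow_le_pow_left₀ (by positivity) hpn _)
    refine le_trans ?_ h2
    have h3 : min (θ / 2) (δ / (n₀ + 1)) * n ≤ δ :=
      calc min (θ / 2) (δ / (n₀ + 1)) * n ≤ δ / (n₀ + 1) * (n₀ + 1) := by
            gcongr
            exact min_le_right _ _
        _ = δ := div_mul_cancel₀ _ hn0.ne'
    linarith [Real.one_sub_le_exp_neg (min (θ / 2) (δ / (n₀ + 1)) * n)]
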